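/- Let $q$ be an indeterminate and write $(t)_k=(1-t)(1-tq)\cdots(1-tq^{k-1})$; in particular $(q)_k=(1-q)(1-q^2)\cdots(1-q^k)$. Write $\chi(S)=1$ if the statement $S$ is true and $\chi(S)=0$ otherwise, and let $\mathrm{CT}[\,\cdot\,]$ denote the constant term of a Laurent polynomial. For an $(n+1)\times(n+1)$ matrix $B=(\beta_{ij})_{0\le i,j\le n}$ of nonnegative integers with zero diagonal put $$L_q(x_0,x;B)=\prod_{0\le i<j\le n}\left(\frac{x_i}{x_j}\right)_{\beta_{ij}}\left(\frac{qx_j}{x_i}\right)_{\beta_{ji}}.$$ Let $n$ be a positive integer, let $a,b,k$ be nonnegative integers and let $0\le n_0\le n$. For $0\le m\le n$ let $B_{AF}$ be the matrix with zero diagonal whose off-diagonal entries are: $\beta_{0j}=b$ for $1\le j\le n$; $\beta_{i0}=a+\chi(i>n-m)$ for $1\le i\le n$; and, for $1\le i\ne j\le n$, $\beta_{ij}=k+1$ if $i,j>n_0$ and $\beta_{ij}=k$ otherwise. Let $B_F$ be this matrix for $m=0$. Put $e_j=kj+\chi(j>n_0)(j-n_0)$. (i) If $m\le n\le m+n_0$,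 then $$\mathrm{CT}[L_q(x_0,x;B_{AF})]=\prod_{j=0}^{n-1}\frac{(q)_{a+b+e_j+\chi(j\ge n-m)}\,(q)_{e_j+k}}{(q)_{a+e_j+\chi(j\ge n-m)}\,(q)_{b+e_j}\,(q)_k}\times\prod_{j=1}^{n-n_0}\frac{1-q^{(k+1)j}}{1-q^{k+1}}.$$ (ii) (Baker–Forrester conjecture.) For every $0\le n_0\le n$, $$\mathrm{CT}[L_q(x_0,x;B_{F})]=\prod_{j=0}^{n-1}\frac{(q)_{a+b+e_j}\,(q)_{e_j+k}}{(q)_{a+e_j}\,(q)_{b+e_j}\,(q)_k}\times\prod_{j=1}^{n-n_0}\frac{1-q^{(k+1)j}}{1-q^{k+1}}.$$ (iii) (Forrester's conjecture.) For every $0\le n_0\le n$, $$\mathrm{CT}\Bigg[\prod_{j=1}^n(1-x_j)^a\Big(1-\frac1{x_j}\Big)^b\prod_{1\le i\ne j\le n}\Big(1-\frac{x_i}{x_j}\Big)^k\prod_{n_0<i\ne j\le n}\Big(1-\frac{x_i}{x_j}\Big)\Bigg]=\prod_{j=0}^{n_0-1}\frac{(a+b+kj)!\,(kj+k)!}{(a+kj)!\,(b+kj)!\,k!}$$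 $$\times\prod_{j=0}^{n-n_0-1}\frac{(j+1)\,(a+b+kn_0+(k+1)j)!\,(kn_0+(k+1)j+k)!}{(a+kn_0+(k+1)j)!\,(b+kn_0+(k+1)j)!\,k!}.$$ -/

import Mathlib

/-- Laurent polynomials over `R` in the indeterminates `x_i` (`i : ι`): finite formal
`R`-linear combinations of monomials with exponent vectors `ι →₀ ℤ`. -/
abbrev LaurentPoly (R ι : Type*) [CommRing R] : Type _ :=
  AddMonoidAlgebra R (ι →₀ ℤ)

namespace LaurentPoly

/-- The monomial `x_i ^ e`, for an integer `e`. -/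
noncomputable def varPow (R : Type*) {ι : Type*} [CommRing R] (i : ι) (e : ℤ) :
    LaurentPoly R ι :=
  AddMonoidAlgebra.single (Finsupp.single i e) 1

/-- The monomial `x_i / x_j`. -/
noncomputable def ratio (R : Type*) {ι : Type*} [CommRing R] (i j : ι) : LaurentPoly R ι :=
  varPow R i 1 * varPow R j (-1)

/-- The constant term, i.e. the coefficient of the monomial all of whose exponents are zero. -/
def constTerm {R ι : Type*} [CommRing R] (f : LaurentPoly R ι) : R :=
  f.coeff 0

end LaurentPoly

/-- The `q`-Pochhammer symbol `(t)_k = (1 - t) (1 - t q) ⋯ (1 - t q ^ (k - 1))`. -/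
def qPoch {A : Type*} [CommRing A] (q t : A) (k : ℕ) : A :=
  ∏ s ∈ Finset.range k, (1 - t * q ^ s)

/-- `(q)_k = (1 - q) (1 - q ^ 2) ⋯ (1 - q ^ k)`. -/
def qFac {A : Type*} [CommRing A] (q : A) (k : ℕ) : A :=
  qPoch q q k

/-- The `q`-Laurent polynomial of a matrix `B` of exponents with rows and columns `0, …, n`:
`∏_{0 ≤ i < j ≤ n} (x_i / x_j)_{B i j} (q x_j / x_i)_{B j i}`. -/
noncomputable def qLaurent {R : Type*} [CommRing R] (q : R) {n : ℕ}
    (B : Matrix (Fin (n + 1)) (Fin (n + 1)) ℕ) : LaurentPoly R (Fin (n + 1)) :=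
  ∏ i : Fin (n + 1), ∏ j ∈ Finset.Ioi i,
    (qPoch (algebraMap R (LaurentPoly R (Fin (n + 1))) q)
        (LaurentPoly.ratio R i j) (B i j) *
      qPoch (algebraMap R (LaurentPoly R (Fin (n + 1))) q)
        (algebraMap R (LaurentPoly R (Fin (n + 1))) q * LaurentPoly.ratio R j i) (B j i))

/-- The overlay of the Aomoto matrix and the Forrester matrix, rows and columns `0, …, n`.
The diagonal is zero; the rest of row `0` is `b`; in column `0` the entry of row `i ≥ 1` is
`a + 1` for the last `m` rows (`i > n - m`) and `a` for the others; and the remaining entries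
are `k + 1` if both indices exceed `n₀` and `k` otherwise. -/
def aomotoForresterMatrix (n m n₀ a b k : ℕ) : Matrix (Fin (n + 1)) (Fin (n + 1)) ℕ :=
  fun i j =>
    if i = j then 0
    else if i = 0 then b
    else if j = 0 then (if n < (i : ℕ) + m then a + 1 else a)
    else if n₀ < (i : ℕ) ∧ n₀ < (j : ℕ) then k + 1
    else k

/-- The Forrester matrix, rows and columns `0, …, n`. -/
def forresterMatrix (n n₀ a b k : ℕ) : Matrix (Fin (n + 1)) (Fin (n + 1)) ℕ :=
  fun i j =>
    if i = j then 0
    else if i = 0 then b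
    else if j = 0 then a
    else if n₀ < (i : ℕ) ∧ n₀ < (j : ℕ) then k + 1
    else k

/-- The exponent `k j + χ(j > n₀) (j - n₀)`. -/
def shiftExp (n₀ k j : ℕ) : ℕ :=
  k * j + if n₀ < j then j - n₀ else 0

/-- Forrester's Laurent polynomial in the indeterminates `x_1, …, x_n` (here `x_{i+1}` is
indexed by `i : Fin n`):
`∏_j (1 - x_j)^a (1 - 1/x_j)^b * ∏_{i ≠ j} (1 - x_i/x_j)^k * ∏_{n₀ < i ≠ j ≤ n} (1 - x_i/x_j)`. -/
noncomputable def forresterPoly (R : Type*) [CommRing R] (n n₀ a b k : ℕ) :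
    LaurentPoly R (Fin n) :=
  (∏ j : Fin n,
      (1 - LaurentPoly.varPow R j 1) ^ a * (1 - LaurentPoly.varPow R j (-1)) ^ b) *
    (∏ i : Fin n, ∏ j : Fin n, if i = j then 1 else (1 - LaurentPoly.ratio R i j) ^ k) *
    (∏ i : Fin n, ∏ j : Fin n,
      if i ≠ j ∧ n₀ ≤ (i : ℕ) ∧ n₀ ≤ (j : ℕ) then 1 - LaurentPoly.ratio R i j else 1)

/-- The product `∏_{j=0}^{n-1} (a+b+kj)! (kj+k)! / ((a+kj)! (b+kj)! k!)`. -/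
def morrisProduct (n a b k : ℕ) : ℚ :=
  ∏ j ∈ Finset.range n,
    (((a + b + k * j).factorial : ℚ) * ((k * j + k).factorial : ℚ)) /
      (((a + k * j).factorial : ℚ) * ((b + k * j).factorial : ℚ) * (k.factorial : ℚ))

/-! The Laurent polynomial is homogeneous of degree zero, so its constant term can be extracted by
Lagrange interpolation in `x_1, …, x_n` alone, with one node more for each variable than its pole
order. Keeping `x_0 = y` free and multiplying by a power of `y` gives a polynomial `Γ(y)` whose
degree is at most the pole order of `x_0` and whose coefficient in that degree is the constant term
(`exists_polynomial_eval_eq`).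

The nodes are powers `q ^ v`, with `v` in `gridExp`. At most grid points the factors not involving
`x_0` vanish. At the others, the sorted exponents are pinned between bounds given by `e_p = shiftExp
n₀ k p` (`exists_perm_shiftExp`), and therefore every surviving summand is divisible, as a
polynomial in `y`, by one fixed monic polynomial `rootPoly` of the maximal degree. Hence `Γ` is the
constant term times `rootPoly` (`gridSum_eq`). For indices below `n₀` the pole order is smaller, and
fewer nodes are allowed; removing the points `b + e_p + 1` is the choice that makes the upper bound
hold.

The interpolation sum for `b` at `y = 1` equals the one for `b = 0` at `y = q ^ (-b)`
(`gridSum_one`), and for `b = 0` the constant term does not depend on `a` and `m`. This determines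
the constant term up to its value at `a = b = 0` (`constTerm_eq_mul_prod`). There `x_0` is absent
and `x_1`, if `n₀ > 0`, plays its part with `a = b = k`, which lowers both `n` and `n₀`. At `n₀ = 0`
all pair exponents are `k + 1`, the uniform case, which the same recursion brings down to `n = 0`.

Forrester's identity follows by setting `x_0 = 1` and specializing `q` to `1` after the common
powers of `1 - q` are cancelled. -/

/-! ### The grid of exponents and separated points on it. -/

/-- The exponent of the pair of indices `i`, `j` (counted from `0`): `k + 1` if both are at
least `n₀` and `k` otherwise. -/
def pairExp (n₀ k i j : ℕ) : ℕ := if n₀ ≤ i ∧ n₀ ≤ j then k + 1 else k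

/-- The exponents `v` of the interpolation nodes `q ^ v` for the variable with index `j`
(counted from `0`): an interval, from which some points are removed when `j < n₀`. -/
def gridExp (n n₀ k b j : ℕ) : Finset ℕ :=
  if n₀ ≤ j then Finset.range (b + shiftExp n₀ k (n - 1) + 1)
  else Finset.range (b + shiftExp n₀ k (n - 1) + 1) \
    (Finset.Ico n₀ (n - 1)).image fun p => b + shiftExp n₀ k p + 1

lemma shiftExp_eq (n₀ k p : ℕ) : shiftExp n₀ k p = k * p + (p - n₀) := by
  unfold shiftExp
  split_ifs with h
  · rfl
  · omega

lemma shiftExp_succ_of_lt {n₀ p : ℕ} (k : ℕ) (h : p < n₀) :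
    shiftExp n₀ k (p + 1) = shiftExp n₀ k p + k := by
  rw [shiftExp_eq, shiftExp_eq, mul_add_one]
  omega

lemma shiftExp_succ_of_le {n₀ p : ℕ} (k : ℕ) (h : n₀ ≤ p) :
    shiftExp n₀ k (p + 1) = shiftExp n₀ k p + k + 1 := by
  rw [shiftExp_eq, shiftExp_eq, mul_add_one]
  omega

lemma shiftExp_strictMonoOn (n₀ k : ℕ) {p p' : ℕ} (h : n₀ ≤ p) (hp : p < p') :
    shiftExp n₀ k p < shiftExp n₀ k p' := by
  rw [shiftExp_eq, shiftExp_eq]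
  have := Nat.mul_le_mul_left k hp.le
  omega

section Chains

variable {n n₀ k : ℕ} {ρ A : ℕ → ℕ}

/-- By injectivity at most `n₀` positions before `p` have a value below `n₀`, and at most `n₀ - 1`
if `ρ p` itself takes up such a value. -/
lemma sub_le_card_filter_range (hinj : ∀ p < n, ∀ p' < n, ρ p = ρ p' → p = p') {p : ℕ}
    (hp : p < n) :
    p - n₀ ≤ ((Finset.range p).filter (n₀ ≤ ρ ·)).card ∧
      (ρ p < n₀ → n₀ ≤ p → p - n₀ + 1 ≤ ((Finset.range p).filter (n₀ ≤ ρ ·)).card) := by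
  have hsplit := Finset.card_filter_add_card_filter_not (s := Finset.range p) (fun x => n₀ ≤ ρ x)
  rw [Finset.card_range] at hsplit
  have hinj' : Set.InjOn ρ ((Finset.range p).filter (fun x => ¬ n₀ ≤ ρ x)) := by
    intro x hx y hy h
    simp only [Finset.coe_filter, Finset.mem_range, Set.mem_ofPred_eq] at hx hy
    exact hinj x (by omega) y (by omega) h
  constructor
  · have : ((Finset.range p).filter (fun x => ¬ n₀ ≤ ρ x)).card ≤ (Finset.range n₀).card := by
      refine Finset.card_le_card_of_injOn ρ ?_ hinj'
      intro x hx
      simp only [Finset.coe_filter, Finset.mem_range, Set.mem_ofPred_eq] at hx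
      simp only [Finset.coe_range, Set.mem_Iio]
      omega
    rw [Finset.card_range] at this
    omega
  · intro hs hle
    have : ((Finset.range p).filter (fun x => ¬ n₀ ≤ ρ x)).card ≤
        ((Finset.range n₀).erase (ρ p)).card := by
      refine Finset.card_le_card_of_injOn ρ ?_ hinj'
      intro x hx
      simp only [Finset.coe_filter, Finset.mem_range, Set.mem_ofPred_eq] at hx
      simp only [Finset.coe_erase, Finset.coe_range, Set.mem_sdiff, Set.mem_Iio,
        Set.mem_singleton_iff]
      refine ⟨by omega, fun h => ?_⟩
      have := hinj x (by omega) p hp h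
      omega
    rw [Finset.card_erase_of_mem (Finset.mem_range.2 hs), Finset.card_range] at this
    omega

/-- Consecutive gaps add up: each is at least `k`, with one more unit whenever its left end carries
an index at least `n₀`. -/
lemma le_of_gap_of_card
    (gap : ∀ p p', p < p' → p' < n →
      A p + k + (if n₀ ≤ ρ p ∨ ρ p' < ρ p then 1 else 0) ≤ A p')
    {p : ℕ} (hp : p < n) : k * p + ((Finset.range p).filter (n₀ ≤ ρ ·)).card ≤ A p := by
  induction p with
  | zero => simp
  | succ p ih =>
    have h1 := ih (by omega)
    have h2 := gap p (p + 1) (by omega) hp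
    rw [Finset.range_add_one, Finset.filter_insert, mul_add_one]
    split_ifs with h
    · rw [Finset.card_insert_of_notMem (by simp)]
      rw [if_pos (Or.inl h)] at h2
      omega
    · omega

/-- To get below `ρ p₁`, the sequence must descend somewhere between `p₁` and `p`, and a descent
makes its gap larger by one. -/
lemma le_of_gap_of_descent
    (gap : ∀ p p', p < p' → p' < n →
      A p + k + (if n₀ ≤ ρ p ∨ ρ p' < ρ p then 1 else 0) ≤ A p')
    {p₁ p : ℕ} (hle : p₁ ≤ p) (hp : p < n) :
    k * p + (if ρ p < ρ p₁ then 1 else 0) ≤ A p := by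
  induction p, hle using Nat.le_induction with
  | base =>
    rw [if_neg (lt_irrefl _)]
    have := le_of_gap_of_card gap hp
    omega
  | succ p hle ih =>
    have h1 := ih (by omega)
    have h2 := gap p (p + 1) (by omega) hp
    rw [mul_add_one]
    split_ifs at h1 h2 ⊢ <;> omega

/-- Downward induction from `p = n - 1`, where the size of the grid gives the bound. For `n₀ ≤ p`
the bound drops by `k + 1` while the gap may be only `k`; the points removed from the grid rule out
the resulting excess of one. -/
lemma le_shiftExp_of_gap {b : ℕ}
    (gap : ∀ p p', p < p' → p' < n →
      A p + k + (if n₀ ≤ ρ p ∨ ρ p' < ρ p then 1 else 0) ≤ A p')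
    (hmem : ∀ p < n, A p ∈ gridExp n n₀ k b (ρ p)) {p : ℕ} (hp : p < n) :
    A p ≤ b + shiftExp n₀ k p := by
  obtain ⟨d, hd⟩ : ∃ d, p + d = n - 1 := ⟨n - 1 - p, by omega⟩
  induction d generalizing p with
  | zero =>
    have := hmem p hp
    unfold gridExp at this
    obtain rfl : p = n - 1 := by omega
    split_ifs at this with h
    · rw [Finset.mem_range] at this
      omega
    · rw [Finset.mem_sdiff, Finset.mem_range] at this
      omega
  | succ d ih =>
    have h1 := ih (p := p + 1) (by omega) (by omega)
    have h2 := gap p (p + 1) (by omega) (by omega)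
    rcases lt_or_ge p n₀ with h | h
    · rw [shiftExp_succ_of_lt k h] at h1
      omega
    · rw [shiftExp_succ_of_le k h] at h1
      by_contra hlt
      -- The bound can fail only by one unit. Then the gap is exactly `k`, so `ρ p < n₀`, and for
      -- such an index this very value is missing from the grid.
      have h3 : A p = b + shiftExp n₀ k p + 1 := by omega
      have h4 : ¬ n₀ ≤ ρ p := by
        intro h5
        rw [if_pos (Or.inl h5)] at h2
        omega
      have h5 := hmem p hp
      unfold gridExp at h5
      rw [if_neg h4, Finset.mem_sdiff, Finset.mem_image] at h5
      exact h5.2 ⟨p, Finset.mem_Ico.2 ⟨h, by omega⟩, h3.symm⟩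

/-- Counting indices at least `n₀` yields the exponent itself. One unit more is needed when `n - m ≤
p` but `ρ p < n - m`. Since then `ρ p < n₀`, the sharper count supplies it if `n₀ ≤ p`; otherwise a
descent does. -/
lemma shiftExp_add_le_of_gap {m : ℕ} (hm : m = 0 ∨ n ≤ m + n₀)
    (hinj : ∀ p < n, ∀ p' < n, ρ p = ρ p' → p = p') (hlt : ∀ p < n, ρ p < n)
    (gap : ∀ p p', p < p' → p' < n →
      A p + k + (if n₀ ≤ ρ p ∨ ρ p' < ρ p then 1 else 0) ≤ A p')
    {p : ℕ} (hp : p < n) :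
    shiftExp n₀ k p + (if n ≤ p + m then 1 else 0) ≤
      A p + (if n ≤ ρ p + m then 1 else 0) := by
  have h1 := sub_le_card_filter_range (n₀ := n₀) hinj hp
  have h2 := le_of_gap_of_card gap hp
  rw [shiftExp_eq]
  by_cases hc : n ≤ ρ p + m
  · rw [if_pos hc]
    split_ifs <;> omega
  rw [if_neg hc]
  by_cases hd : n ≤ p + m
  swap
  · rw [if_neg hd]
    omega
  rw [if_pos hd]
  have hm' : n ≤ m + n₀ := by
    rcases hm with rfl | h
    · omega
    · exact h
  rcases le_or_gt n₀ p with h | h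
  · have := h1.2 (by omega) h
    omega
  -- Pigeonhole: the `p + 1 > n - m` positions up to `p` cannot all have values below `n - m`.
  · obtain ⟨p₁, hp₁, hρ⟩ : ∃ p₁ ≤ p, n ≤ ρ p₁ + m := by
      by_contra! hall
      have : (Finset.range (p + 1)).card ≤ (Finset.range (n - m)).card := by
        refine Finset.card_le_card_of_injOn ρ ?_ ?_
        · intro x hx
          simp only [Finset.coe_range, Set.mem_Iio] at hx ⊢
          have := hall x (by omega)
          omega
        · intro x hx y hy hxy
          simp only [Finset.coe_range, Set.mem_Iio] at hx hy
          exact hinj x (by omega) y (by omega) hxy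
      rw [Finset.card_range, Finset.card_range] at this
      have := hlt p hp
      omega
    have h3 := le_of_gap_of_descent gap hp₁ hp
    rw [if_pos (by omega)] at h3
    omega

end Chains

/-- Points of the grid which satisfy the separation condition can be sorted in such a way that
the sorted sequence is controlled from both sides by the exponents `shiftExp n₀ k p`. -/
theorem exists_perm_shiftExp {n n₀ k b m : ℕ} (hm : m = 0 ∨ n ≤ m + n₀) (α : Fin n → ℕ)
    (hα : ∀ j : Fin n, α j ∈ gridExp n n₀ k b j)
    (hsep : ∀ i j : Fin n, i < j → α i + pairExp n₀ k i j ≤ α j ∨ α j + pairExp n₀ k i j + 1 ≤ α i) :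
    ∃ π : Equiv.Perm (Fin n), ∀ p : Fin n, α (π p) ≤ b + shiftExp n₀ k p ∧
      shiftExp n₀ k p + (if n ≤ p + m then 1 else 0) ≤
        α (π p) + (if n ≤ (π p : ℕ) + m then 1 else 0) := by
  -- Equal exponents, possible when a pair exponent is `0`, are ordered by index, so that every
  -- descent of indices comes with a strict increase of exponents.
  set f : Fin n → ℕ ×ₗ Fin n := fun j => toLex (α j, j)
  set π := Tuple.sort f
  have hmono : ∀ p p' : Fin n, p < p' →
      α (π p) < α (π p') ∨ α (π p) = α (π p') ∧ π p < π p' := by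
    intro p p' h
    have h1 : f (π p) ≤ f (π p') := Tuple.monotone_sort f h.le
    rw [Prod.Lex.toLex_le_toLex] at h1
    refine h1.imp_right fun h2 => ⟨h2.1, lt_of_le_of_ne h2.2 fun h3 => ?_⟩
    exact h.ne (π.injective h3)
  have hgap : ∀ p p' : Fin n, p < p' →
      α (π p) + k + (if n₀ ≤ (π p : ℕ) ∨ (π p' : ℕ) < π p then 1 else 0) ≤ α (π p') := by
    intro p p' h
    have h1 := hmono p p' h
    have hne : π p ≠ π p' := fun h3 => h.ne (π.injective h3)
    rcases lt_or_gt_of_ne hne with h2 | h2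
    · have h3 := hsep _ _ h2
      have h4 : (π p : ℕ) < π p' := h2
      unfold pairExp at h3
      split_ifs at h3 ⊢ <;> omega
    · have h3 := hsep _ _ h2
      have h4 : (π p' : ℕ) < π p := h2
      have h5 : ¬ π p < π p' := h2.asymm
      rw [if_pos (Or.inr h4)]
      unfold pairExp at h3
      split_ifs at h3 <;> omega
  set ρ : ℕ → ℕ := fun p => if h : p < n then (π ⟨p, h⟩ : ℕ) else 0
  set A : ℕ → ℕ := fun p => if h : p < n then α (π ⟨p, h⟩) else 0
  have hρ : ∀ p (h : p < n), ρ p = π ⟨p, h⟩ := fun p h => dif_pos h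
  have hA : ∀ p (h : p < n), A p = α (π ⟨p, h⟩) := fun p h => dif_pos h
  have gap : ∀ p p', p < p' → p' < n →
      A p + k + (if n₀ ≤ ρ p ∨ ρ p' < ρ p then 1 else 0) ≤ A p' := by
    intro p p' h h'
    rw [hρ p (h.trans h'), hρ p' h', hA p (h.trans h'), hA p' h']
    exact hgap _ _ h
  have hinj : ∀ p < n, ∀ p' < n, ρ p = ρ p' → p = p' := by
    intro p hp p' hp' h
    rw [hρ p hp, hρ p' hp'] at h
    simpa using π.injective (Fin.ext h)
  have hlt : ∀ p < n, ρ p < n := fun p hp => by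
    rw [hρ p hp]
    exact (π ⟨p, hp⟩).2
  have hmem : ∀ p < n, A p ∈ gridExp n n₀ k b (ρ p) := fun p hp => by
    rw [hρ p hp, hA p hp]
    exact hα _
  refine ⟨π, fun p => ?_⟩
  have h1 := le_shiftExp_of_gap gap hmem p.2
  have h2 := shiftExp_add_le_of_gap hm hinj hlt gap p.2
  rw [hA p p.2] at h1 h2
  rw [hρ p p.2] at h2
  exact ⟨h1, h2⟩

/-- One more than the pole order of the variable, as interpolation requires; the removed points are
distinct and lie in the range because `shiftExp` increases strictly from `n₀` on. -/
lemma card_gridExp {n n₀ k b j : ℕ} :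
    (gridExp n n₀ k b j).card =
      b + (n - 1) * k + (if n₀ ≤ j then n - 1 - n₀ else 0) + 1 := by
  unfold gridExp
  split_ifs with h
  · rw [Finset.card_range, shiftExp_eq, mul_comm]
    omega
  · rw [Finset.card_sdiff_of_subset, Finset.card_range, Finset.card_image_of_injOn, Nat.card_Ico,
      shiftExp_eq, mul_comm]
    · omega
    · intro p hp p' hp' hpp
      simp only [Finset.coe_Ico, Set.mem_Ico] at hp hp'
      rcases lt_trichotomy p p' with hlt | heq | hlt
      · have := shiftExp_strictMonoOn n₀ k hp.1 hlt
        simp only at hpp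
        omega
      · exact heq
      · have := shiftExp_strictMonoOn n₀ k hp'.1 hlt
        simp only at hpp
        omega
    · intro v hv
      obtain ⟨p, hp, rfl⟩ := Finset.mem_image.1 hv
      rw [Finset.mem_Ico] at hp
      have := shiftExp_strictMonoOn n₀ k hp.1 hp.2
      rw [Finset.mem_range]
      omega

/-- Increasing `b` shifts the grid and fills up its beginning. -/
lemma gridExp_eq_union (n n₀ k b : ℕ) {j : ℕ} :
    gridExp n n₀ k b j =
      Finset.range b ∪ (gridExp n n₀ k 0 j).map (addLeftEmbedding b) := by
  ext v
  simp only [Finset.mem_union, Finset.mem_range, Finset.mem_map, addLeftEmbedding_apply]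
  unfold gridExp
  split_ifs with h
  · simp only [Finset.mem_range]
    constructor
    · intro hv
      rcases lt_or_ge v b with h1 | h1
      · exact Or.inl h1
      · exact Or.inr ⟨v - b, by omega, by omega⟩
    · rintro (h1 | ⟨w, hw, rfl⟩) <;> omega
  · simp only [Finset.mem_sdiff, Finset.mem_range, Finset.mem_image, Finset.mem_Ico, not_exists,
      not_and]
    constructor
    · rintro ⟨hv, hv'⟩
      rcases lt_or_ge v b with h1 | h1
      · exact Or.inl h1
      · refine Or.inr ⟨v - b, ⟨by omega, fun p hp h2 => hv' p hp (by omega)⟩, by omega⟩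
    · rintro (h1 | ⟨w, ⟨hw, hw'⟩, rfl⟩)
      · exact ⟨by omega, fun p hp => by omega⟩
      · exact ⟨by omega, fun p hp h2 => hw' p hp (by omega)⟩

/-! ### Pole orders, evaluation and coefficient extraction. -/

open Polynomial in
/-- The weights of Lagrange interpolation extract a coefficient: they annihilate the powers
`z ^ e` with `-σ ≤ e < 0` and take the value `1` at `e = 0`. -/
lemma sum_zpow_mul_nodeWeight {K : Type*} [Field K] {v : ℕ → K} {s : Finset ℕ}
    (hv : Set.InjOn v s) (hv₀ : ∀ i, v i ≠ 0) {σ : ℕ} (hs : s.card = σ + 1) {e : ℤ}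
    (h₁ : -(σ : ℤ) ≤ e) (h₂ : e ≤ 0) :
    ∑ i ∈ s, v i ^ e * (v i ^ σ / ∏ j ∈ s.erase i, (v i - v j)) = if e = 0 then 1 else 0 := by
  obtain ⟨d, hd⟩ : ∃ d : ℕ, (d : ℤ) = e + σ := ⟨(e + σ).toNat, by omega⟩
  have h := Lagrange.coeff_eq_sum hv (P := (X : K[X]) ^ d) (by
    rw [degree_X_pow, hs]
    exact_mod_cast (by omega : d < σ + 1))
  rw [hs, Nat.add_sub_cancel, coeff_X_pow] at h
  have h3 : (if e = 0 then (1 : K) else 0) = if σ = d then 1 else 0 := by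
    congr 1
    exact propext ⟨fun _ => by omega, fun _ => by omega⟩
  rw [h3, h]
  refine Finset.sum_congr rfl fun i _ => ?_
  rw [eval_pow, eval_X, ← mul_div_assoc, ← zpow_natCast, ← zpow_natCast, hd, zpow_add₀ (hv₀ i)]

namespace LaurentPoly

section Support

variable {R ι : Type*} [CommRing R]

lemma algebraMap_mul_ratio (r : R) (i j : ι) :
    algebraMap R (LaurentPoly R ι) r * ratio R i j =
      AddMonoidAlgebra.single (Finsupp.single i 1 + Finsupp.single j (-1)) r := by
  simp [ratio, varPow, AddMonoidAlgebra.single_mul_single]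

variable [Fintype ι]

/-- All monomials of `f` have total degree zero, and the exponent of `x_i` in them is at
least `-σ i`. -/
def PolesLE (σ : ι → ℕ) (f : LaurentPoly R ι) : Prop :=
  ∀ e ∈ f.coeff.support, ∑ i, e i = 0 ∧ ∀ i, -(σ i : ℤ) ≤ e i

lemma PolesLE.mono {σ τ : ι → ℕ} {f : LaurentPoly R ι} (hf : PolesLE σ f) (h : σ ≤ τ) :
    PolesLE τ f := fun e he => ⟨(hf e he).1, fun i => by
  have := (hf e he).2 i
  have : σ i ≤ τ i := h i
  omega⟩

lemma PolesLE.single {σ : ι → ℕ} {e : ι →₀ ℤ} (r : R) (h : ∑ i, e i = 0)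
    (h' : ∀ i, -(σ i : ℤ) ≤ e i) :
    PolesLE σ (AddMonoidAlgebra.single e r : LaurentPoly R ι) := by
  intro e' he'
  rw [AddMonoidAlgebra.coeff_single] at he'
  obtain rfl := Finset.mem_singleton.1 (Finsupp.support_single_subset he')
  exact ⟨h, h'⟩

lemma PolesLE.one : PolesLE 0 (1 : LaurentPoly R ι) :=
  PolesLE.single 1 (by simp) (by simp)

lemma PolesLE.sub {σ : ι → ℕ} {f g : LaurentPoly R ι} (hf : PolesLE σ f)
    (hg : PolesLE σ g) : PolesLE σ (f - g) := by
  classical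
  intro e he
  rw [AddMonoidAlgebra.coeff_sub] at he
  rcases Finset.mem_union.1 (Finsupp.support_sub he) with h | h
  exacts [hf e h, hg e h]

lemma PolesLE.mul {σ τ : ι → ℕ} {f g : LaurentPoly R ι} (hf : PolesLE σ f)
    (hg : PolesLE τ g) : PolesLE (σ + τ) (f * g) := by
  classical
  intro e he
  obtain ⟨e₁, h₁, e₂, h₂, rfl⟩ := Finset.mem_add.1
    (AddMonoidAlgebra.support_coeff_mul_subset f g he)
  refine ⟨by simp [Finset.sum_add_distrib, (hf e₁ h₁).1, (hg e₂ h₂).1], fun i => ?_⟩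
  have := (hf e₁ h₁).2 i
  have := (hg e₂ h₂).2 i
  rw [Finsupp.add_apply, Pi.add_apply]
  push_cast
  omega

lemma PolesLE.prod {κ : Type*} {s : Finset κ} {σ : κ → ι → ℕ} {f : κ → LaurentPoly R ι}
    (h : ∀ x ∈ s, PolesLE (σ x) (f x)) : PolesLE (∑ x ∈ s, σ x) (∏ x ∈ s, f x) := by
  classical
  induction s using Finset.induction_on with
  | empty => simpa using PolesLE.one
  | insert x s hx ih =>
    rw [Finset.sum_insert hx, Finset.prod_insert hx]
    exact (h x (by simp)).mul (ih fun y hy => h y (by simp [hy]))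

lemma PolesLE.qPoch [DecidableEq ι] (q r : R) {i j : ι} (hij : i ≠ j) (k : ℕ) :
    PolesLE (Pi.single j k) (qPoch (algebraMap R (LaurentPoly R ι) q)
      (algebraMap R (LaurentPoly R ι) r * ratio R i j) k) := by
  have hk : (Pi.single j k : ι → ℕ) = ∑ _t ∈ Finset.range k, Pi.single j 1 := by
    rw [Finset.sum_const, Finset.card_range, ← Pi.single_smul]
    simp
  rw [hk]
  refine PolesLE.prod fun t _ => (PolesLE.one.mono (by simp)).sub ?_
  rw [mul_right_comm, ← map_pow, ← map_mul, algebraMap_mul_ratio]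
  refine PolesLE.single _ ?_ fun l => ?_
  · simp [Finset.sum_add_distrib, Finsupp.single_apply]
  · rw [Finsupp.add_apply, Finsupp.single_apply, Finsupp.single_apply, Pi.single_apply]
    by_cases h1 : i = l <;> by_cases h2 : j = l
    · exact absurd (h1.trans h2.symm) hij
    all_goals simp [h1, h2, Ne.symm]

/-- A Laurent polynomial whose monomials have total degree zero keeps its constant term when
`x_0` is replaced by `1`. -/
lemma PolesLE.eq_zero_of_tail {n : ℕ} {σ : Fin (n + 1) → ℕ} {f : LaurentPoly R (Fin (n + 1))}
    (hf : PolesLE σ f) {e : Fin (n + 1) →₀ ℤ} (he : e ∈ f.coeff.support)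
    (h : ∀ j : Fin n, e j.succ = 0) : e = 0 := by
  have h1 := (hf e he).1
  rw [Fin.sum_univ_succ] at h1
  simp only [h, Finset.sum_const_zero, add_zero] at h1
  ext j
  induction j using Fin.cases with
  | zero => simpa using h1
  | succ j => simpa using h j

end Support

section Eval

variable {K ι : Type*} [Field K] [Fintype ι]

/-- The evaluation of Laurent polynomials at a point with nonzero coordinates. -/
noncomputable def evalAt (c : ι → Kˣ) : LaurentPoly K ι →ₐ[K] K :=
  AddMonoidAlgebra.lift K K (ι →₀ ℤ)
    { toFun := fun e => ∏ i, (c i : K) ^ (e.toAdd i)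
      map_one' := by simp
      map_mul' := fun e e' => by
        rw [← Finset.prod_mul_distrib]
        exact Finset.prod_congr rfl fun i _ => by
          rw [toAdd_mul, Finsupp.add_apply, zpow_add₀ (c i).ne_zero] }

lemma evalAt_single (c : ι → Kˣ) (e : ι →₀ ℤ) (r : K) :
    evalAt c (AddMonoidAlgebra.single e r) = r * ∏ i, (c i : K) ^ e i := by
  simp [evalAt]

lemma evalAt_eq_sum (c : ι → Kˣ) (f : LaurentPoly K ι) :
    evalAt c f = ∑ e ∈ f.coeff.support, f.coeff e * ∏ i, (c i : K) ^ e i := by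
  rw [evalAt, AddMonoidAlgebra.lift_apply]
  rfl

lemma evalAt_ratio (c : ι → Kˣ) (i j : ι) : evalAt c (ratio K i j) = c i / c j := by
  classical
  rw [ratio, map_mul, varPow, varPow, evalAt_single, evalAt_single]
  simp only [Finsupp.single_apply, one_mul]
  rw [Finset.prod_eq_single i, Finset.prod_eq_single j]
  · simp [div_eq_mul_inv]
  · intro l _ hl
    simp [hl.symm]
  · simp
  · intro l _ hl
    simp [hl.symm]
  · simp

end Eval

end LaurentPoly

lemma map_qPoch {A A' F : Type*} [CommRing A] [CommRing A'] [FunLike F A A']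
    [RingHomClass F A A'] (φ : F) (q t : A) (k : ℕ) : φ (qPoch q t k) = qPoch (φ q) (φ t) k := by
  simp [qPoch, map_prod]

open Polynomial LaurentPoly in
/-- Interpolation on a grid in the variables `x_1, …, x_n` turns a Laurent polynomial into a
polynomial in `x_0` whose leading coefficient is the constant term. -/
lemma exists_polynomial_eval_eq {K : Type*} [Field K] {n : ℕ} {u : ℕ → Kˣ}
    (hu : Function.Injective u) {s : Fin n → Finset ℕ} {σ : Fin (n + 1) → ℕ}
    (hs : ∀ j, (s j).card = σ j.succ + 1) {f : LaurentPoly K (Fin (n + 1))}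
    (hf : PolesLE σ f) :
    ∃ Γ : K[X], Γ.natDegree ≤ σ 0 ∧ Γ.coeff (σ 0) = constTerm f ∧
      ∀ y : Kˣ, Γ.eval (y : K) = (y : K) ^ σ 0 *
        ∑ α ∈ Fintype.piFinset s, evalAt (Fin.cons y fun j => u (α j)) f *
          ∏ j, ((u (α j) : K) ^ σ j.succ /
            ∏ v ∈ (s j).erase (α j), ((u (α j) : K) - (u v : K))) := by
  set h : Fin n → ℤ → K := fun j z => ∑ v ∈ s j, (u v : K) ^ z *
    ((u v : K) ^ σ j.succ / ∏ w ∈ (s j).erase v, ((u v : K) - (u w : K))) with h_def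
  have hh : ∀ j z, -(σ j.succ : ℤ) ≤ z → z ≤ 0 → h j z = if z = 0 then 1 else 0 := by
    intro j z h₁ h₂
    refine sum_zpow_mul_nodeWeight (v := fun v => (u v : K)) ?_ (fun i => (u i).ne_zero) (hs j)
      h₁ h₂
    intro x _ y _ hxy
    exact hu (Units.ext hxy)
  -- Total degree zero forces a negative exponent in some other variable, and the weights kill it.
  -- So monomials with a positive power of `x_0` do not raise the degree.
  have hneg : ∀ e ∈ f.coeff.support, 0 < e 0 → ∏ j : Fin n, h j (e j.succ) = 0 := by
    intro e he h0
    have h1 := (hf e he).1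
    rw [Fin.sum_univ_succ] at h1
    obtain ⟨j, -, hj⟩ : ∃ j ∈ Finset.univ, e (Fin.succ j) < 0 := by
      by_contra! hcon
      have := Finset.sum_nonneg hcon
      omega
    exact Finset.prod_eq_zero (Finset.mem_univ j) (by
      rw [hh j _ ((hf e he).2 _) hj.le, if_neg hj.ne])
  have hzero : ∀ e ∈ f.coeff.support, e 0 = 0 →
      ∏ j : Fin n, h j (e j.succ) = if e = 0 then 1 else 0 := by
    intro e he h0
    split_ifs with he0
    · refine Finset.prod_eq_one fun j _ => ?_
      rw [hh j _ ((hf e he).2 _) (by simp [he0]), if_pos (by simp [he0])]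
    · have h1 := (hf e he).1
      rw [Fin.sum_univ_succ, h0, zero_add] at h1
      obtain ⟨j, -, hj⟩ : ∃ j ∈ Finset.univ, e (Fin.succ j) < 0 := by
        by_contra! hcon
        have := (Finset.sum_eq_zero_iff_of_nonneg hcon).1 h1
        exact he0 (hf.eq_zero_of_tail he fun j => this j (Finset.mem_univ j))
      exact Finset.prod_eq_zero (Finset.mem_univ j) (by
        rw [hh j _ ((hf e he).2 _) hj.le, if_neg hj.ne])
  -- The pole bound makes `σ 0 + e 0` nonnegative, so `toNat` truncates nothing.
  refine ⟨∑ e ∈ f.coeff.support, C (f.coeff e * ∏ j : Fin n, h j (e j.succ)) *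
    X ^ (σ 0 + e 0).toNat, ?_, ?_, ?_⟩
  · refine natDegree_sum_le_of_forall_le _ _ fun e he => ?_
    rcases lt_or_ge 0 (e 0) with h0 | h0
    · rw [hneg e he h0]
      simp
    · refine (natDegree_C_mul_X_pow_le _ _).trans ?_
      omega
  · rw [finsetSum_coeff]
    have : ∀ e ∈ f.coeff.support,
        (C (f.coeff e * ∏ j : Fin n, h j (e j.succ)) * X ^ (σ 0 + e 0).toNat).coeff (σ 0) =
          if e = 0 then f.coeff 0 else 0 := by
      intro e he
      rw [coeff_C_mul_X_pow]
      have h0 := (hf e he).2 0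
      by_cases h1 : e 0 = 0
      · rw [if_pos (by omega), hzero e he h1]
        split_ifs with h2
        · simp [h2]
        · simp
      · rw [if_neg (by omega), if_neg]
        rintro rfl
        simp at h1
    rw [Finset.sum_congr rfl this, Finset.sum_ite_eq']
    split_ifs with h1
    · rfl
    · exact (Finsupp.notMem_support_iff.1 h1).symm
  · intro y
    rw [eval_finsetSum]
    simp_rw [evalAt_eq_sum, Finset.sum_mul]
    rw [Finset.sum_comm, Finset.mul_sum]
    refine Finset.sum_congr rfl fun e he => ?_
    have h0 := (hf e he).2 0
    have hy : (y : K) ^ (σ 0 + e 0).toNat = (y : K) ^ σ 0 * (y : K) ^ e 0 := by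
      rw [← zpow_natCast, ← zpow_natCast, ← zpow_add₀ y.ne_zero]
      congr 1
      omega
    rw [eval_mul, eval_C, eval_pow, eval_X, hy, h_def]
    simp_rw [Fin.prod_univ_succ (n := n), Fin.cons_zero, Fin.cons_succ]
    rw [Finset.prod_univ_sum, Finset.mul_sum, Finset.sum_mul, Finset.mul_sum]
    refine Finset.sum_congr rfl fun α _ => ?_
    rw [Finset.prod_mul_distrib]
    ring

/-! ### Matrix entries and pole orders of the Aomoto–Forrester polynomial. -/

section

open LaurentPoly Polynomial

section Matrix

variable {n m n₀ a b k : ℕ}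

lemma aomotoForresterMatrix_zero_succ (j : Fin n) :
    aomotoForresterMatrix n m n₀ a b k 0 j.succ = b := by
  simp [aomotoForresterMatrix, (Fin.succ_ne_zero j).symm]

lemma aomotoForresterMatrix_succ_zero (j : Fin n) :
    aomotoForresterMatrix n m n₀ a b k j.succ 0 = a + if n ≤ (j : ℕ) + m then 1 else 0 := by
  simp only [aomotoForresterMatrix, Fin.succ_ne_zero, if_false, if_true, Fin.val_succ]
  split_ifs <;> omega

lemma aomotoForresterMatrix_succ_succ {i j : Fin n} (hij : i ≠ j) :
    aomotoForresterMatrix n m n₀ a b k i.succ j.succ = pairExp n₀ k i j := by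
  simp [aomotoForresterMatrix, pairExp, Fin.succ_inj, hij]

lemma forresterMatrix_eq : forresterMatrix n n₀ a b k = aomotoForresterMatrix n 0 n₀ a b k := by
  ext i j
  unfold forresterMatrix aomotoForresterMatrix
  have := i.2
  rw [if_neg (c := n < (i : ℕ) + 0) (by omega)]

lemma pairExp_comm (i j : ℕ) : pairExp n₀ k i j = pairExp n₀ k j i := by
  simp [pairExp, and_comm]

lemma sum_pairExp_le (l : Fin n) :
    ∑ i ∈ Finset.univ.erase l, pairExp n₀ k i l ≤
      (n - 1) * k + if n₀ ≤ (l : ℕ) then n - 1 - n₀ else 0 := by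
  have hcard : (Finset.univ.erase l).card = n - 1 := by
    rw [Finset.card_erase_of_mem (Finset.mem_univ l), Finset.card_fin]
  unfold pairExp
  split_ifs with h
  · have h1 : ∀ i : Fin n, (if n₀ ≤ (i : ℕ) ∧ n₀ ≤ (l : ℕ) then k + 1 else k) =
        k + if n₀ ≤ (i : ℕ) then 1 else 0 := fun i => by split_ifs <;> omega
    simp_rw [h1]
    rw [Finset.sum_add_distrib, Finset.sum_const, hcard, smul_eq_mul, Finset.sum_boole]
    have h2 : ((Finset.univ.erase l).filter fun i : Fin n => n₀ ≤ (i : ℕ)).card ≤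
        ((Finset.Ico n₀ n).erase l).card := by
      refine Finset.card_le_card_of_injOn Fin.val ?_ Fin.val_injective.injOn
      intro i hi
      simp only [Finset.coe_filter, Finset.mem_erase, Finset.mem_univ, and_true,
        Set.mem_ofPred_eq] at hi
      simp only [Finset.coe_erase, Finset.coe_Ico, Set.mem_sdiff, Set.mem_Ico,
        Set.mem_singleton_iff]
      exact ⟨⟨hi.2, i.2⟩, fun h => hi.1 (Fin.ext h)⟩
    rw [Finset.card_erase_of_mem (Finset.mem_Ico.2 ⟨h, l.2⟩), Nat.card_Ico] at h2
    simp only [Nat.cast_id]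
    omega
  · have h1 : ∀ i : Fin n, (if n₀ ≤ (i : ℕ) ∧ n₀ ≤ (l : ℕ) then k + 1 else k) = k :=
      fun i => if_neg fun h' => h h'.2
    simp_rw [h1]
    rw [Finset.sum_const, hcard, smul_eq_mul, add_zero]

lemma prod_Ioi_zero {M : Type*} [CommMonoid M] (g : Fin (n + 1) → M) :
    ∏ j ∈ Finset.Ioi (0 : Fin (n + 1)), g j = ∏ j : Fin n, g j.succ := by
  rw [Fin.Ioi_zero_eq_map, Finset.prod_map]
  rfl

lemma prod_Ioi_succ {M : Type*} [CommMonoid M] (i : Fin n) (g : Fin (n + 1) → M) :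
    ∏ j ∈ Finset.Ioi i.succ, g j = ∏ j ∈ Finset.Ioi i, g j.succ := by
  rw [← Fin.map_succEmb_Ioi, Finset.prod_map]
  rfl

lemma qLaurent_eq_mul {R : Type*} [CommRing R] (q : R)
    (B : Matrix (Fin (n + 1)) (Fin (n + 1)) ℕ) :
    qLaurent q B =
      (∏ j : Fin n,
        (qPoch (algebraMap R (LaurentPoly R (Fin (n + 1))) q) (ratio R 0 j.succ) (B 0 j.succ) *
          qPoch (algebraMap R (LaurentPoly R (Fin (n + 1))) q)
            (algebraMap R (LaurentPoly R (Fin (n + 1))) q * ratio R j.succ 0) (B j.succ 0))) *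
      ∏ i : Fin n, ∏ j ∈ Finset.Ioi i,
        (qPoch (algebraMap R (LaurentPoly R (Fin (n + 1))) q) (ratio R i.succ j.succ)
            (B i.succ j.succ) *
          qPoch (algebraMap R (LaurentPoly R (Fin (n + 1))) q)
            (algebraMap R (LaurentPoly R (Fin (n + 1))) q * ratio R j.succ i.succ)
            (B j.succ i.succ)) := by
  rw [qLaurent, Fin.prod_univ_succ, prod_Ioi_zero]
  simp_rw [prod_Ioi_succ]

/-- The exponents of the denominator of the Aomoto–Forrester Laurent polynomial. -/
def aomotoForresterPoles (n m n₀ a b k : ℕ) : Fin (n + 1) → ℕ :=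
  Fin.cons (∑ j : Fin n, (a + if n ≤ (j : ℕ) + m then 1 else 0))
    fun j => b + ((n - 1) * k + if n₀ ≤ (j : ℕ) then n - 1 - n₀ else 0)

/-- A Pochhammer factor in `x_i / x_j` or its `q`-multiple has a pole only in `x_j`, of order at
most its length; these orders are added up. -/
lemma polesLE_qLaurent {R : Type*} [CommRing R] (q : R) :
    PolesLE (aomotoForresterPoles n m n₀ a b k)
      (qLaurent q (aomotoForresterMatrix n m n₀ a b k)) := by
  rw [qLaurent_eq_mul]
  have hone : ∀ i j : Fin (n + 1), ratio R i j =
      algebraMap R (LaurentPoly R (Fin (n + 1))) 1 * ratio R i j := fun i j => by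
    rw [map_one, one_mul]
  have h1 := PolesLE.prod (s := (Finset.univ : Finset (Fin n)))
    (f := fun j : Fin n =>
        (qPoch (algebraMap R (LaurentPoly R (Fin (n + 1))) q) (ratio R 0 j.succ)
            (aomotoForresterMatrix n m n₀ a b k 0 j.succ) *
          qPoch (algebraMap R (LaurentPoly R (Fin (n + 1))) q)
            (algebraMap R (LaurentPoly R (Fin (n + 1))) q * ratio R j.succ 0)
            (aomotoForresterMatrix n m n₀ a b k j.succ 0)))
    (σ := fun j => Pi.single j.succ b +
      Pi.single 0 (a + if n ≤ (j : ℕ) + m then 1 else 0)) (by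
      intro j _
      rw [aomotoForresterMatrix_zero_succ, aomotoForresterMatrix_succ_zero, hone 0]
      exact (PolesLE.qPoch _ _ (Fin.succ_ne_zero j).symm _).mul
        (PolesLE.qPoch _ _ (Fin.succ_ne_zero j) _))
  have h2 := PolesLE.prod (s := (Finset.univ : Finset (Fin n)))
    (f := fun i : Fin n => ∏ j ∈ Finset.Ioi i,
        (qPoch (algebraMap R (LaurentPoly R (Fin (n + 1))) q) (ratio R i.succ j.succ)
            (aomotoForresterMatrix n m n₀ a b k i.succ j.succ) *
          qPoch (algebraMap R (LaurentPoly R (Fin (n + 1))) q)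
            (algebraMap R (LaurentPoly R (Fin (n + 1))) q * ratio R j.succ i.succ)
            (aomotoForresterMatrix n m n₀ a b k j.succ i.succ)))
    (σ := fun i => ∑ j ∈ Finset.Ioi i, (Pi.single j.succ (pairExp n₀ k i j) +
      Pi.single i.succ (pairExp n₀ k i j))) (by
      intro i _
      refine PolesLE.prod fun j hj => ?_
      have hij : i ≠ j := (Finset.mem_Ioi.1 hj).ne
      rw [aomotoForresterMatrix_succ_succ hij, aomotoForresterMatrix_succ_succ hij.symm,
        pairExp_comm (j : ℕ), hone i.succ]
      exact (PolesLE.qPoch _ _ (by simpa [Fin.succ_inj] using hij) _).mul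
        (PolesLE.qPoch _ _ (by simpa [Fin.succ_inj] using hij.symm) _))
  refine (h1.mul h2).mono fun l => ?_
  induction l using Fin.cases with
  | zero =>
    simp [aomotoForresterPoles, Finset.sum_apply, (Fin.succ_ne_zero _).symm]
  | succ l =>
    have h3 : (∑ i : Fin n, ∑ j ∈ Finset.Ioi i,
        (Pi.single j.succ (pairExp n₀ k i j) +
          Pi.single i.succ (pairExp n₀ k i j)) : Fin (n + 1) → ℕ) l.succ =
        ∑ i ∈ Finset.univ.erase l, pairExp n₀ k i l := by
      have h4 : ∀ i : Fin n, (Finset.Ioi i) = Finset.univ.filter (i < ·) := fun i => by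
        ext; simp
      -- Only pairs containing `l` matter: those with `l` as the larger index and those with `l` as
      -- the smaller are separated.
      have h5 : ∀ i j : Fin n, (if i < j then ((if l = j then pairExp n₀ k i j else 0) +
          if l = i then pairExp n₀ k i j else 0) else 0) =
          (if l = j then (if i < l then pairExp n₀ k i l else 0) else 0) +
          (if l = i then (if l < j then pairExp n₀ k l j else 0) else 0) := by
        intro i j
        rcases eq_or_ne l j with rfl | hj
        · rcases eq_or_ne l i with rfl | hi
          · simp
          · simp [hi]
        · rcases eq_or_ne l i with rfl | hi
          · simp [hj]
          · simp [hi, hj]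
      simp only [Finset.sum_apply, Pi.add_apply, Pi.single_apply, Fin.succ_inj]
      simp_rw [h4, Finset.sum_filter]
      simp_rw [h5, Finset.sum_add_distrib]
      rw [Finset.sum_comm (γ := Fin n) (f := fun i j =>
        (if l = i then (if l < j then pairExp n₀ k l j else 0) else 0))]
      simp only [Finset.sum_ite_eq, Finset.mem_univ, if_true]
      rw [← Finset.sum_add_distrib, ← Finset.filter_ne', Finset.sum_filter]
      refine Finset.sum_congr rfl fun i _ => ?_
      rcases lt_trichotomy i l with h | h | h
      · simp [h, h.not_gt, h.ne]
      · simp [h]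
      · simp [h, h.not_gt, h.ne', pairExp_comm (l : ℕ)]
    have h6 : (∑ j : Fin n, (Pi.single j.succ b +
        Pi.single 0 (a + if n ≤ (j : ℕ) + m then 1 else 0)) : Fin (n + 1) → ℕ) l.succ = b := by
      simp [Finset.sum_apply, Pi.single_apply, Fin.succ_inj]
    rw [Pi.add_apply, h3, h6, aomotoForresterPoles, Fin.cons_succ]
    exact Nat.add_le_add_left (sum_pairExp_le l) b

end Matrix

end

/-! ### Divisibility of the surviving summands by a common polynomial. -/

section

open LaurentPoly Polynomial

section Field

variable {K : Type*} [Field K]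

/-- The factor of the evaluated Laurent polynomial which does not involve `x_0`. -/
noncomputable def pairProd (q : K) {n : ℕ} (n₀ k : ℕ) (c : Fin n → K) : K :=
  ∏ i : Fin n, ∏ j ∈ Finset.Ioi i,
    (qPoch q (c i / c j) (pairExp n₀ k i j) * qPoch q (q * (c j / c i)) (pairExp n₀ k i j))

/-- The interpolation weights of the grid. -/
noncomputable def gridWeight (q : K) (n n₀ k b j v : ℕ) : K :=
  (q ^ v) ^ (b + ((n - 1) * k + if n₀ ≤ j then n - 1 - n₀ else 0)) /
    ∏ w ∈ (gridExp n n₀ k b j).erase v, (q ^ v - q ^ w)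

/-- The dependence of the evaluated Laurent polynomial on `x_0`. -/
noncomputable def rowPoly (q : K) {n : ℕ} (m a b : ℕ) (α : Fin n → ℕ) : K[X] :=
  ∏ j : Fin n, ((∏ t ∈ Finset.range b, (1 - C (q ^ t / q ^ α j) * X)) *
    ∏ t ∈ Finset.range (a + if n ≤ (j : ℕ) + m then 1 else 0), (X - C (q ^ (t + 1) * q ^ α j)))

/-- The polynomial with the roots `q ^ (e + t)`, `1 ≤ t ≤ a` or `1 ≤ t ≤ a + 1`, where `e` runs
through the exponents `shiftExp n₀ k p`. -/
noncomputable def rootPoly (q : K) (n m n₀ a k : ℕ) : K[X] :=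
  ∏ p : Fin n, ∏ t ∈ Finset.range (a + if n ≤ (p : ℕ) + m then 1 else 0),
    (X - C (q ^ (shiftExp n₀ k p + t + 1)))

/-- The interpolation sum over the grid. -/
noncomputable def gridSum (q : K) (n m n₀ a b k : ℕ) (y : K) : K :=
  ∑ α ∈ Fintype.piFinset fun j : Fin n => gridExp n n₀ k b j,
    ((∏ j : Fin n, (qPoch q (y / q ^ α j) b *
        qPoch q (q * (q ^ α j / y)) (a + if n ≤ (j : ℕ) + m then 1 else 0))) *
      pairProd q n₀ k fun j => q ^ α j) *
    ∏ j : Fin n, gridWeight q n n₀ k b j (α j)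

lemma evalAt_qLaurent {n m n₀ a b k : ℕ} (q : K) (c : Fin (n + 1) → Kˣ) :
    evalAt c (qLaurent q (aomotoForresterMatrix n m n₀ a b k)) =
      (∏ j : Fin n, (qPoch q (c 0 / c j.succ) b *
        qPoch q (q * (c j.succ / c 0)) (a + if n ≤ (j : ℕ) + m then 1 else 0))) *
      pairProd q n₀ k fun j => (c j.succ : K) := by
  rw [qLaurent_eq_mul, map_mul, map_prod, map_prod, pairProd]
  congr 1
  · refine Finset.prod_congr rfl fun j _ => ?_
    rw [map_mul, map_qPoch, map_qPoch, map_mul, AlgHom.commutes, evalAt_ratio, evalAt_ratio,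
      aomotoForresterMatrix_zero_succ, aomotoForresterMatrix_succ_zero]
    rfl
  · refine Finset.prod_congr rfl fun i _ => ?_
    rw [map_prod]
    refine Finset.prod_congr rfl fun j hj => ?_
    have hij : i ≠ j := (Finset.mem_Ioi.1 hj).ne
    rw [map_mul, map_qPoch, map_qPoch, map_mul, AlgHom.commutes, evalAt_ratio, evalAt_ratio,
      aomotoForresterMatrix_succ_succ hij, aomotoForresterMatrix_succ_succ hij.symm,
      pairExp_comm (j : ℕ)]
    rfl

variable {q : K} {n m n₀ a b k : ℕ}

lemma qPoch_eq_zero_iff {t : K} : qPoch q t k = 0 ↔ ∃ s < k, t * q ^ s = 1 := by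
  simp [qPoch, Finset.prod_eq_zero_iff, sub_eq_zero, @eq_comm K 1]

lemma eval_rowPoly (α : Fin n → ℕ) {y : K} (hy : y ≠ 0) :
    (rowPoly q m a b α).eval y =
      y ^ (∑ j : Fin n, (a + if n ≤ (j : ℕ) + m then 1 else 0)) *
        ∏ j : Fin n, (qPoch q (y / q ^ α j) b *
          qPoch q (q * (q ^ α j / y)) (a + if n ≤ (j : ℕ) + m then 1 else 0)) := by
  rw [rowPoly, eval_prod, ← Finset.prod_pow_eq_pow_sum, ← Finset.prod_mul_distrib]
  refine Finset.prod_congr rfl fun j _ => ?_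
  rw [eval_mul, eval_prod, eval_prod, mul_left_comm, qPoch, qPoch]
  congr 1
  · refine Finset.prod_congr rfl fun t _ => ?_
    simp only [eval_sub, eval_one, eval_mul, eval_C, eval_X]
    ring
  · generalize (a + if n ≤ (j : ℕ) + m then 1 else 0) = A
    have h1 : y ^ A = ∏ _t ∈ Finset.range A, y := by rw [Finset.prod_const, Finset.card_range]
    rw [h1, ← Finset.prod_mul_distrib]
    refine Finset.prod_congr rfl fun t _ => ?_
    simp only [eval_sub, eval_C, eval_X]
    field_simp
    ring

/-- With `β` the pair exponent, the first factor vanishes for `0 ≤ α j - α i < β` and the second for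
`1 ≤ α i - α j ≤ β`; the asymmetry is due to the extra `q` in the second. -/
lemma separated_of_pairProd_ne_zero (hq : q ≠ 0) {α : Fin n → ℕ}
    (h : pairProd q n₀ k (fun j => q ^ α j) ≠ 0) {i j : Fin n} (hij : i < j) :
    α i + pairExp n₀ k i j ≤ α j ∨ α j + pairExp n₀ k i j + 1 ≤ α i := by
  have h1 := Finset.prod_ne_zero_iff.1 (Finset.prod_ne_zero_iff.1 h i (Finset.mem_univ i)) j
    (Finset.mem_Ioi.2 hij)
  by_contra! hcon
  rcases le_or_gt (α i) (α j) with h2 | h2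
  · refine left_ne_zero_of_mul h1 (qPoch_eq_zero_iff.2 ⟨α j - α i, by omega, ?_⟩)
    rw [div_mul_eq_mul_div, ← pow_add, Nat.add_sub_cancel' h2, div_self (pow_ne_zero _ hq)]
  · refine right_ne_zero_of_mul h1 (qPoch_eq_zero_iff.2 ⟨α i - α j - 1, by omega, ?_⟩)
    rw [mul_div_assoc', div_mul_eq_mul_div, ← pow_succ', ← pow_add,
      show α j + 1 + (α i - α j - 1) = α i by omega, div_self (pow_ne_zero _ hq)]

/-- The product on the right has the roots `q ^ v` with `α - b < v ≤ α + B`, an interval of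
exponents which by hypothesis contains `e < v ≤ e + A`. -/
lemma prod_X_sub_C_dvd (hq : Function.Injective fun i : ℕ => q ^ i) {e A B α : ℕ}
    (h₁ : α ≤ b + e) (h₂ : e + A ≤ α + B) :
    ∏ t ∈ Finset.range A, (X - C (q ^ (e + t + 1))) ∣
      (∏ t ∈ Finset.range b, (1 - C (q ^ t / q ^ α) * X)) *
        ∏ t ∈ Finset.range B, (X - C (q ^ (t + 1) * q ^ α)) := by
  have hq₀ : q ≠ 0 := by
    rintro rfl
    have := @hq 1 2 (by simp)
    omega
  refine Finset.prod_dvd_of_coprime (fun t _ t' _ htt => ?_) fun t ht => ?_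
  · refine pairwise_coprime_X_sub_C (s := fun t : ℕ => q ^ (e + t + 1)) (fun x y hxy => ?_) htt
    have := hq hxy
    omega
  rw [Finset.mem_range] at ht
  rw [dvd_iff_isRoot, IsRoot.def, eval_mul, eval_prod, eval_prod]
  rcases le_or_gt (e + t + 1) α with h | h
  · refine mul_eq_zero_of_left (Finset.prod_eq_zero (i := α - (e + t + 1))
      (Finset.mem_range.2 (by omega)) ?_) _
    rw [eval_sub, eval_one, eval_mul, eval_C, eval_X, div_mul_eq_mul_div, ← pow_add,
      Nat.sub_add_cancel h, div_self (pow_ne_zero _ hq₀), sub_self]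
  · refine mul_eq_zero_of_right _ (Finset.prod_eq_zero (i := e + t - α)
      (Finset.mem_range.2 (by omega)) ?_)
    rw [eval_sub, eval_C, eval_X, ← pow_add,
      show e + t - α + 1 + α = e + t + 1 by omega, sub_self]

lemma rootPoly_dvd_rowPoly (hq : Function.Injective fun i : ℕ => q ^ i) (hq₀ : q ≠ 0)
    (hm : m = 0 ∨ n ≤ m + n₀) {α : Fin n → ℕ} (hα : ∀ j : Fin n, α j ∈ gridExp n n₀ k b j)
    (h : pairProd q n₀ k (fun j => q ^ α j) ≠ 0) :
    rootPoly q n m n₀ a k ∣ rowPoly q m a b α := by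
  obtain ⟨π, hπ⟩ := exists_perm_shiftExp hm α hα fun i j hij =>
    separated_of_pairProd_ne_zero hq₀ h hij
  rw [rootPoly, rowPoly]
  refine dvd_trans ?_ (dvd_of_eq (Equiv.prod_comp π _))
  refine Finset.prod_dvd_prod_of_dvd _ _ fun p _ => ?_
  refine prod_X_sub_C_dvd hq (hπ p).1 ?_
  have := (hπ p).2
  omega

lemma monic_rootPoly : (rootPoly q n m n₀ a k).Monic :=
  monic_prod_of_monic _ _ fun _ _ => monic_prod_of_monic _ _ fun _ _ => monic_X_sub_C _

lemma natDegree_rootPoly : (rootPoly q n m n₀ a k).natDegree =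
    ∑ j : Fin n, (a + if n ≤ (j : ℕ) + m then 1 else 0) := by
  rw [rootPoly, natDegree_prod_of_monic _ _ fun _ _ =>
    monic_prod_of_monic _ _ fun _ _ => monic_X_sub_C _]
  refine Finset.sum_congr rfl fun p _ => ?_
  rw [natDegree_prod_of_monic _ _ fun _ _ => monic_X_sub_C _]
  simp only [natDegree_X_sub_C, Finset.sum_const, Finset.card_range, smul_eq_mul, mul_one]

lemma coeff_rowPoly_zero (α : Fin n → ℕ) :
    (rowPoly q m a 0 α).coeff (∑ j : Fin n, (a + if n ≤ (j : ℕ) + m then 1 else 0)) = 1 := by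
  have h1 : rowPoly q m a 0 α = ∏ j : Fin n,
      ∏ t ∈ Finset.range (a + if n ≤ (j : ℕ) + m then 1 else 0),
        (X - C (q ^ (t + 1) * q ^ α j)) := by
    simp [rowPoly]
  have h2 : (rowPoly q m a 0 α).Monic := by
    rw [h1]
    exact monic_prod_of_monic _ _ fun _ _ => monic_prod_of_monic _ _ fun _ _ => monic_X_sub_C _
  have h3 : (rowPoly q m a 0 α).natDegree =
      ∑ j : Fin n, (a + if n ≤ (j : ℕ) + m then 1 else 0) := by
    rw [h1, natDegree_prod_of_monic _ _ fun _ _ =>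
      monic_prod_of_monic _ _ fun _ _ => monic_X_sub_C _]
    refine Finset.sum_congr rfl fun p _ => ?_
    rw [natDegree_prod_of_monic _ _ fun _ _ => monic_X_sub_C _]
    simp only [natDegree_X_sub_C, Finset.sum_const, Finset.card_range, smul_eq_mul, mul_one]
  rw [← h3]
  exact h2

/-- The last description exhibits `Γ` as a combination of the `rowPoly`, which is what divisibility
arguments and coefficient comparison need. -/
lemma exists_interpolation (hq : Function.Injective fun i : ℕ => q ^ i) (hq₀ : q ≠ 0) :
    ∃ Γ : K[X], Γ.natDegree ≤ ∑ j : Fin n, (a + if n ≤ (j : ℕ) + m then 1 else 0) ∧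
      Γ.coeff (∑ j : Fin n, (a + if n ≤ (j : ℕ) + m then 1 else 0)) =
        constTerm (qLaurent q (aomotoForresterMatrix n m n₀ a b k)) ∧
      (∀ y : K, y ≠ 0 → Γ.eval y =
        y ^ (∑ j : Fin n, (a + if n ≤ (j : ℕ) + m then 1 else 0)) *
          gridSum q n m n₀ a b k y) ∧
      Γ = ∑ α ∈ Fintype.piFinset fun j : Fin n => gridExp n n₀ k b j,
        C ((pairProd q n₀ k fun j => q ^ α j) * ∏ j : Fin n, gridWeight q n n₀ k b j (α j)) *
          rowPoly q m a b α := by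
  have hu : Function.Injective fun v : ℕ => Units.mk0 q hq₀ ^ v := by
    intro v w h
    refine hq ?_
    simpa [Units.ext_iff] using h
  obtain ⟨Γ, h1, h2, h3⟩ := exists_polynomial_eval_eq hu
    (s := fun j : Fin n => gridExp n n₀ k b j) (σ := aomotoForresterPoles n m n₀ a b k)
    (fun j => by rw [card_gridExp, aomotoForresterPoles, Fin.cons_succ, add_assoc b])
    (polesLE_qLaurent (m := m) (a := a) q)
  rw [aomotoForresterPoles, Fin.cons_zero] at h1 h2 h3
  have h4 : ∀ y : K, y ≠ 0 → Γ.eval y =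
        y ^ (∑ j : Fin n, (a + if n ≤ (j : ℕ) + m then 1 else 0)) *
          gridSum q n m n₀ a b k y := by
    intro y hy
    have h5 := h3 (Units.mk0 y hy)
    rw [Units.val_mk0] at h5
    rw [h5, gridSum]
    congr 1
    refine Finset.sum_congr rfl fun α _ => ?_
    rw [evalAt_qLaurent]
    simp [gridWeight]
  refine ⟨Γ, h1, h2, h4, ?_⟩
  refine eq_of_infinite_eval_eq _ _ (Set.infinite_of_injective_forall_mem hq fun i => ?_)
  have hy : q ^ i ≠ 0 := pow_ne_zero _ hq₀
  rw [Set.mem_ofPred_eq, h4 _ hy, eval_finsetSum, gridSum, Finset.mul_sum]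
  refine Finset.sum_congr rfl fun α _ => ?_
  rw [eval_mul, eval_C, eval_rowPoly α hy]
  ring

/-- The interpolation sum equals the constant term times the polynomial `rootPoly`. -/
lemma gridSum_eq (hq : Function.Injective fun i : ℕ => q ^ i) (hq₀ : q ≠ 0)
    (hm : m = 0 ∨ n ≤ m + n₀) {y : K} (hy : y ≠ 0) :
    y ^ (∑ j : Fin n, (a + if n ≤ (j : ℕ) + m then 1 else 0)) * gridSum q n m n₀ a b k y =
      constTerm (qLaurent q (aomotoForresterMatrix n m n₀ a b k)) *
        (rootPoly q n m n₀ a k).eval y := by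
  obtain ⟨Γ, h1, h2, h3, h4⟩ := exists_interpolation (n := n) (m := m) (n₀ := n₀) (a := a)
    (b := b) (k := k) hq hq₀
  have hdvd : rootPoly q n m n₀ a k ∣ Γ := by
    rw [h4]
    refine Finset.dvd_sum fun α hα => ?_
    by_cases h : pairProd q n₀ k (fun j => q ^ α j) = 0
    · simp [h]
    · exact (rootPoly_dvd_rowPoly hq hq₀ hm (Fintype.mem_piFinset.1 hα) h).mul_left _
  -- The degree of `rootPoly` equals the degree bound for `Γ`, so the quotient is a constant.
  have h5 := eq_leadingCoeff_mul_of_monic_of_dvd_of_natDegree_le monic_rootPoly hdvd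
    (by rwa [natDegree_rootPoly])
  have h6 : Γ.leadingCoeff = constTerm (qLaurent q (aomotoForresterMatrix n m n₀ a b k)) := by
    rw [← h2]
    conv_rhs => rw [h5, coeff_C_mul, ← natDegree_rootPoly (q := q) (n₀ := n₀) (k := k),
      Monic.coeff_natDegree monic_rootPoly, mul_one]
  rw [← h3 y hy, ← h6]
  conv_lhs => rw [h5, eval_mul, eval_C]

/-- For `b = 0` the constant term does not depend on `a` and `m`. -/
lemma constTerm_zero_eq (hq : Function.Injective fun i : ℕ => q ^ i) (hq₀ : q ≠ 0) :
    constTerm (qLaurent q (aomotoForresterMatrix n m n₀ a 0 k)) =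
      ∑ α ∈ Fintype.piFinset fun j : Fin n => gridExp n n₀ k 0 j,
        (pairProd q n₀ k fun j => q ^ α j) * ∏ j : Fin n, gridWeight q n n₀ k 0 j (α j) := by
  obtain ⟨Γ, -, h2, -, h4⟩ := exists_interpolation (n := n) (m := m) (n₀ := n₀) (a := a)
    (b := 0) (k := k) hq hq₀
  rw [← h2, h4, finsetSum_coeff]
  refine Finset.sum_congr rfl fun α _ => ?_
  rw [coeff_C_mul, coeff_rowPoly_zero, mul_one]

end Field

end

/-! ### Dependence on `a`, `b` and `m`. -/

section

open LaurentPoly Polynomial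

section Field

variable {K : Type*} [Field K] {q : K} {n m n₀ a b k : ℕ}

/-- The `b` additional nodes put `∏ (q ^ (b + v) - q ^ w)`, `w < b`, into the denominator of the
weight; up to a power of `q` this is the Pochhammer factor in front. -/
lemma qPoch_inv_mul_gridWeight_add (hq : Function.Injective fun i : ℕ => q ^ i) (hq₀ : q ≠ 0)
    {j v : ℕ} (hv : v ∈ gridExp n n₀ k 0 j) :
    qPoch q (1 / q ^ (b + v)) b * gridWeight q n n₀ k b j (b + v) =
      gridWeight q n n₀ k 0 j v := by
  have hne : qPoch q (1 / q ^ (b + v)) b ≠ 0 := by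
    intro h
    obtain ⟨s, hs, h1⟩ := qPoch_eq_zero_iff.1 h
    rw [div_mul_eq_mul_div, one_mul, div_eq_one_iff_eq (pow_ne_zero _ hq₀)] at h1
    have := hq h1
    omega
  have h1 : (gridExp n n₀ k b j).erase (b + v) =
      Finset.range b ∪ ((gridExp n n₀ k 0 j).erase v).map (addLeftEmbedding b) := by
    rw [gridExp_eq_union, Finset.map_erase, addLeftEmbedding_apply, Finset.erase_union_distrib,
      Finset.erase_eq_of_notMem (s := Finset.range b) (by simp)]
  have h2 : Disjoint (Finset.range b)
      (((gridExp n n₀ k 0 j).erase v).map (addLeftEmbedding b)) := by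
    rw [Finset.disjoint_left]
    intro w hw hw'
    obtain ⟨u, -, rfl⟩ := Finset.mem_map.1 hw'
    simp at hw
  have h3 : ∏ w ∈ Finset.range b, (q ^ (b + v) - q ^ w) =
      (q ^ (b + v)) ^ b * qPoch q (1 / q ^ (b + v)) b := by
    have h4 : (q ^ (b + v)) ^ b = ∏ _w ∈ Finset.range b, q ^ (b + v) := by
      rw [Finset.prod_const, Finset.card_range]
    rw [h4, qPoch, ← Finset.prod_mul_distrib]
    refine Finset.prod_congr rfl fun w _ => ?_
    rw [mul_sub, mul_one, div_mul_eq_mul_div, one_mul, mul_div_cancel₀ _ (pow_ne_zero _ hq₀)]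
  have h5 : ∏ w ∈ ((gridExp n n₀ k 0 j).erase v).map (addLeftEmbedding b),
      (q ^ (b + v) - q ^ w) =
      (q ^ b) ^ ((n - 1) * k + if n₀ ≤ j then n - 1 - n₀ else 0) *
        ∏ w ∈ (gridExp n n₀ k 0 j).erase v, (q ^ v - q ^ w) := by
    have hcard : ((gridExp n n₀ k 0 j).erase v).card =
        (n - 1) * k + if n₀ ≤ j then n - 1 - n₀ else 0 := by
      rw [Finset.card_erase_of_mem hv, card_gridExp, zero_add, Nat.add_sub_cancel]
    rw [Finset.prod_map, ← hcard, ← Finset.prod_const, ← Finset.prod_mul_distrib]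
    refine Finset.prod_congr rfl fun w _ => ?_
    rw [addLeftEmbedding_apply, pow_add, pow_add, mul_sub]
  have hb : (q ^ (b + v)) ^ b ≠ 0 := pow_ne_zero _ (pow_ne_zero _ hq₀)
  rw [gridWeight, gridWeight, h1, Finset.prod_union h2, h3, h5, zero_add]
  generalize ((n - 1) * k + if n₀ ≤ j then n - 1 - n₀ else 0) = s
  have hs : (q ^ b) ^ s ≠ 0 := pow_ne_zero _ (pow_ne_zero _ hq₀)
  have h6 : (q ^ (b + v)) ^ (b + s) = (q ^ (b + v)) ^ b * (q ^ b) ^ s * (q ^ v) ^ s := by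
    rw [pow_add _ b s, pow_add q b v, mul_pow _ _ s, mul_assoc]
  rw [h6]
  field_simp

lemma pairProd_add (hq₀ : q ≠ 0) (α : Fin n → ℕ) :
    pairProd q n₀ k (fun j => q ^ (b + α j)) = pairProd q n₀ k fun j => q ^ α j := by
  unfold pairProd
  simp_rw [pow_add, mul_div_mul_left _ _ (pow_ne_zero b hq₀)]

/-- Raising `b` amounts to a dilation of the argument of the interpolation sum. -/
lemma gridSum_one (hq : Function.Injective fun i : ℕ => q ^ i) (hq₀ : q ≠ 0) :
    gridSum q n m n₀ a b k 1 = gridSum q n m n₀ a 0 k (q ^ b)⁻¹ := by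
  symm
  refine Finset.sum_of_injOn (fun α j => b + α j) ?_ ?_ ?_ ?_
  · intro α _ β _ h
    funext j
    exact Nat.add_left_cancel (congrFun h j)
  · intro α hα
    rw [Finset.mem_coe, Fintype.mem_piFinset] at hα ⊢
    intro j
    rw [gridExp_eq_union]
    exact Finset.mem_union_right _ (Finset.mem_map_of_mem (addLeftEmbedding b) (hα j))
  · intro α hα hα'
    rw [Fintype.mem_piFinset] at hα
    -- Grid points outside the image of the translation have a coordinate below `b`, where `qPoch q
    -- (1 / q ^ α j) b` vanishes.
    obtain ⟨j, hj⟩ : ∃ j, α j < b := by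
      by_contra! hcon
      refine hα' ⟨fun j => α j - b, ?_, funext fun j => Nat.add_sub_cancel' (hcon j)⟩
      rw [Finset.mem_coe, Fintype.mem_piFinset]
      intro j
      have h1 := hα j
      rw [gridExp_eq_union, Finset.mem_union, Finset.mem_range, Finset.mem_map] at h1
      obtain h1 | ⟨w, hw, h1⟩ := h1
      · exact absurd h1 (hcon j).not_gt
      · rw [addLeftEmbedding_apply] at h1
        rwa [← h1, Nat.add_sub_cancel_left]
    rw [Finset.prod_eq_zero (Finset.mem_univ j), zero_mul, zero_mul]
    rw [qPoch_eq_zero_iff.2 ⟨α j, hj, ?_⟩, zero_mul]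
    rw [div_mul_eq_mul_div, one_mul, div_self (pow_ne_zero _ hq₀)]
  · intro α hα
    rw [Fintype.mem_piFinset] at hα
    rw [pairProd_add hq₀, mul_right_comm, mul_right_comm _ (pairProd _ _ _ _)]
    congr 1
    rw [← Finset.prod_mul_distrib, ← Finset.prod_mul_distrib]
    refine Finset.prod_congr rfl fun j _ => ?_
    rw [mul_right_comm, mul_right_comm (qPoch _ _ b),
      qPoch_inv_mul_gridWeight_add hq hq₀ (hα j), div_one, div_inv_eq_mul, pow_add,
      mul_comm (q ^ α j)]
    simp [qPoch]

lemma eval_rootPoly_inv (hq₀ : q ≠ 0) (b : ℕ) :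
    (rootPoly q n m n₀ a k).eval (q ^ b)⁻¹ =
      ((q ^ b)⁻¹) ^ (∑ j : Fin n, (a + if n ≤ (j : ℕ) + m then 1 else 0)) *
      ∏ p : Fin n, qPoch q (q ^ (b + shiftExp n₀ k p + 1))
        (a + if n ≤ (p : ℕ) + m then 1 else 0) := by
  rw [rootPoly, eval_prod, ← Finset.prod_pow_eq_pow_sum, ← Finset.prod_mul_distrib]
  refine Finset.prod_congr rfl fun p _ => ?_
  generalize (a + if n ≤ (p : ℕ) + m then 1 else 0) = A
  have h1 : ((q ^ b)⁻¹) ^ A = ∏ _t ∈ Finset.range A, (q ^ b)⁻¹ := by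
    rw [Finset.prod_const, Finset.card_range]
  rw [eval_prod, h1, qPoch, ← Finset.prod_mul_distrib]
  refine Finset.prod_congr rfl fun t _ => ?_
  rw [eval_sub, eval_X, eval_C, mul_sub, mul_one, ← pow_add,
    show b + shiftExp n₀ k p + 1 + t = b + (shiftExp n₀ k p + t + 1) by omega, pow_add q b,
    inv_mul_cancel_left₀ (pow_ne_zero _ hq₀)]

/-- `gridSum_eq` is compared for `b` at `y = 1` and for `b = 0` at `y = q ^ (-b)`; the power of `y`
cancels against the one produced by `eval_rootPoly_inv`. -/
lemma constTerm_mul_prod_qPoch (hq : Function.Injective fun i : ℕ => q ^ i) (hq₀ : q ≠ 0)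
    (hm : m = 0 ∨ n ≤ m + n₀) :
    constTerm (qLaurent q (aomotoForresterMatrix n m n₀ a b k)) *
        ∏ p : Fin n, qPoch q (q ^ (shiftExp n₀ k p + 1))
          (a + if n ≤ (p : ℕ) + m then 1 else 0) =
      constTerm (qLaurent q (aomotoForresterMatrix n 0 n₀ 0 0 k)) *
        ∏ p : Fin n, qPoch q (q ^ (b + shiftExp n₀ k p + 1))
          (a + if n ≤ (p : ℕ) + m then 1 else 0) := by
  have hy : (q ^ b)⁻¹ ≠ 0 := inv_ne_zero (pow_ne_zero _ hq₀)
  have h1 := gridSum_eq (a := a) (b := b) (k := k) hq hq₀ hm one_ne_zero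
  have h2 := gridSum_eq (a := a) (b := 0) (k := k) hq hq₀ hm hy
  have h3 := eval_rootPoly_inv (n := n) (m := m) (n₀ := n₀) (a := a) (k := k) hq₀ 0
  simp only [pow_zero, inv_one, one_pow, one_mul, zero_add] at h3
  rw [one_pow, one_mul, h3, gridSum_one hq hq₀] at h1
  rw [eval_rootPoly_inv hq₀, mul_left_comm] at h2
  rw [← h1, mul_left_cancel₀ (pow_ne_zero _ hy) h2, constTerm_zero_eq hq hq₀,
    constTerm_zero_eq hq hq₀]

lemma qFac_ne_zero (hq : Function.Injective fun i : ℕ => q ^ i) (e : ℕ) : qFac q e ≠ 0 := by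
  intro h
  obtain ⟨s, -, h1⟩ := qPoch_eq_zero_iff.1 h
  rw [← pow_succ', ← pow_zero q] at h1
  exact absurd (hq h1) (by omega)

lemma qFac_add {A : Type*} [CommRing A] (q : A) (e s : ℕ) :
    qFac q (e + s) = qFac q e * qPoch q (q ^ (e + 1)) s := by
  rw [qFac, qFac, qPoch, qPoch, qPoch, Finset.prod_range_add]
  congr 1
  exact Finset.prod_congr rfl fun t _ => by ring

/-- The dependence of the constant term on `a`, `b` and `m`. -/
lemma constTerm_eq_mul_prod (hq : Function.Injective fun i : ℕ => q ^ i) (hq₀ : q ≠ 0)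
    (hm : m = 0 ∨ n ≤ m + n₀) :
    constTerm (qLaurent q (aomotoForresterMatrix n m n₀ a b k)) =
      constTerm (qLaurent q (aomotoForresterMatrix n 0 n₀ 0 0 k)) *
        ∏ p ∈ Finset.range n,
          (qFac q (a + b + shiftExp n₀ k p + if n ≤ p + m then 1 else 0) *
              qFac q (shiftExp n₀ k p)) /
            (qFac q (a + shiftExp n₀ k p + if n ≤ p + m then 1 else 0) *
              qFac q (b + shiftExp n₀ k p)) := by
  have h1 := constTerm_mul_prod_qPoch (a := a) (b := b) (k := k) hq hq₀ hm
  have hne := qFac_ne_zero hq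
  have h2 : ∏ p : Fin n, qPoch q (q ^ (shiftExp n₀ k p + 1))
      (a + if n ≤ (p : ℕ) + m then 1 else 0) ≠ 0 :=
    Finset.prod_ne_zero_iff.2 fun p _ => by
      have := hne (shiftExp n₀ k p + (a + if n ≤ (p : ℕ) + m then 1 else 0))
      rw [qFac_add] at this
      exact right_ne_zero_of_mul this
  rw [eq_div_of_mul_eq h2 h1, mul_div_assoc, ← Finset.prod_div_distrib, Finset.prod_range]
  congr 1
  refine Finset.prod_congr rfl fun p _ => ?_
  generalize (if n ≤ (p : ℕ) + m then 1 else 0) = c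
  rw [show a + b + shiftExp n₀ k p + c = b + shiftExp n₀ k p + (a + c) by ring,
    show a + shiftExp n₀ k p + c = shiftExp n₀ k p + (a + c) by ring, qFac_add q (b + _),
    qFac_add q (shiftExp n₀ k p) (a + c)]
  have h3 := hne (shiftExp n₀ k p + (a + c))
  rw [qFac_add] at h3
  have h4 := right_ne_zero_of_mul h3
  have h5 := left_ne_zero_of_mul h3
  have h6 := hne (b + shiftExp n₀ k p)
  field_simp

end Field

end

/-! ### The value at `a = b = 0` by recursion. -/

namespace LaurentPoly

variable {R ι κ : Type*} [CommRing R]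

/-- The substitution of variables along a map of the index types. -/
noncomputable def rename (g : ι → κ) : LaurentPoly R ι →+* LaurentPoly R κ :=
  AddMonoidAlgebra.mapDomainRingHom R (Finsupp.mapDomain.addMonoidHom g)

lemma rename_varPow (g : ι → κ) (i : ι) (e : ℤ) : rename g (varPow R i e) = varPow R (g i) e := by
  simp [rename, varPow, Finsupp.mapDomain_single]

lemma rename_ratio (g : ι → κ) (i j : ι) : rename g (ratio R i j) = ratio R (g i) (g j) := by
  rw [ratio, map_mul, rename_varPow, rename_varPow, ratio]

lemma rename_algebraMap (g : ι → κ) (r : R) :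
    rename g (algebraMap R (LaurentPoly R ι) r) = algebraMap R (LaurentPoly R κ) r := by
  simp [rename]

lemma constTerm_rename {g : ι → κ} (hg : Function.Injective g) (f : LaurentPoly R ι) :
    constTerm (rename g f) = constTerm f := by
  have h := Finsupp.mapDomain_apply (Finsupp.mapDomain_injective (M := ℤ) hg) f.coeff 0
  rw [Finsupp.mapDomain_zero] at h
  exact h

end LaurentPoly

section

open LaurentPoly

section Recursion

variable {R : Type*} [CommRing R] {n n₀ k : ℕ}

lemma qPoch_zero {A : Type*} [CommRing A] (q t : A) : qPoch q t 0 = 1 := by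
  simp [qPoch]

lemma aomotoForresterMatrix_succ_eq {i j : Fin (n + 1)} (hij : i ≠ j) :
    aomotoForresterMatrix (n + 1) 0 (n₀ + 1) 0 0 k i.succ j.succ =
      aomotoForresterMatrix n 0 n₀ k k k i j := by
  rw [aomotoForresterMatrix_succ_succ hij]
  have := i.2
  simp only [aomotoForresterMatrix, pairExp, if_neg hij]
  rw [if_neg (c := n < (i : ℕ) + 0) (by omega)]
  rcases eq_or_ne i 0 with rfl | hi
  · simp
  rcases eq_or_ne j 0 with rfl | hj
  · simp
  rw [if_neg hi, if_neg hj]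
  rfl

/-- For `a = b = 0` the variable `x_0` does not occur, and `x_1` can take over its role. -/
lemma constTerm_zero_succ (q : R) :
    constTerm (qLaurent q (aomotoForresterMatrix (n + 1) 0 (n₀ + 1) 0 0 k)) =
      constTerm (qLaurent q (aomotoForresterMatrix n 0 n₀ k k k)) := by
  rw [← constTerm_rename (Fin.succ_injective (n + 1))]
  congr 1
  rw [qLaurent_eq_mul, Finset.prod_eq_one, one_mul, qLaurent, map_prod]
  · refine Finset.prod_congr rfl fun i _ => ?_
    rw [map_prod]
    refine Finset.prod_congr rfl fun j hj => ?_
    have hij : i ≠ j := (Finset.mem_Ioi.1 hj).ne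
    rw [map_mul, map_qPoch, map_qPoch, map_mul, rename_algebraMap, rename_ratio, rename_ratio,
      aomotoForresterMatrix_succ_eq hij, aomotoForresterMatrix_succ_eq hij.symm]
  · intro j _
    have := j.2
    rw [aomotoForresterMatrix_zero_succ, aomotoForresterMatrix_succ_zero,
      if_neg (by omega), qPoch_zero, qPoch_zero, one_mul]

lemma aomotoForresterMatrix_zero_eq :
    aomotoForresterMatrix n 0 0 0 0 k = aomotoForresterMatrix n 0 n 0 0 (k + 1) := by
  ext i j
  have := i.2
  simp only [aomotoForresterMatrix]
  rw [if_neg (c := n < (i : ℕ) + 0) (by omega), if_neg (c := n < (i : ℕ) ∧ n < (j : ℕ)) (by omega)]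
  split_ifs with h1 h2 h3 h4
  · rfl
  · rfl
  · rfl
  · rfl
  · refine absurd ⟨Nat.pos_of_ne_zero fun h => h2 (Fin.ext h),
      Nat.pos_of_ne_zero fun h => h3 (Fin.ext h)⟩ h4

lemma constTerm_qLaurent_zero (q : R) {a b m : ℕ} :
    constTerm (qLaurent q (aomotoForresterMatrix 0 m n₀ a b k)) = 1 := by
  have : qLaurent q (aomotoForresterMatrix 0 m n₀ a b k) = 1 := by
    rw [qLaurent_eq_mul]
    simp
  rw [this, constTerm, AddMonoidAlgebra.one_def, AddMonoidAlgebra.coeff_single,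
    Finsupp.single_eq_same]

end Recursion

section Product

variable {K : Type*} [Field K] {q : K} {n m n₀ a b k : ℕ}

/-- The value of the constant term for `a = b = 0`. -/
noncomputable def baseProd (q : K) (n n₀ k : ℕ) : K :=
  (∏ j ∈ Finset.range n,
    qFac q (shiftExp n₀ k j + k) / (qFac q (shiftExp n₀ k j) * qFac q k)) *
  ∏ j ∈ Finset.Icc 1 (n - n₀), (1 - q ^ ((k + 1) * j)) / (1 - q ^ (k + 1))

lemma qFac_zero {A : Type*} [CommRing A] (q : A) : qFac q 0 = 1 := qPoch_zero q q

lemma qFac_succ {A : Type*} [CommRing A] (q : A) (e : ℕ) :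
    qFac q (e + 1) = qFac q e * (1 - q ^ (e + 1)) := by
  rw [qFac_add]
  simp [qPoch]

lemma constTerm_zero_succ_eq (hq : Function.Injective fun i : ℕ => q ^ i) (hq₀ : q ≠ 0)
    (h : constTerm (qLaurent q (aomotoForresterMatrix n 0 n₀ 0 0 k)) = baseProd q n n₀ k) :
    constTerm (qLaurent q (aomotoForresterMatrix (n + 1) 0 (n₀ + 1) 0 0 k)) =
      baseProd q (n + 1) (n₀ + 1) k := by
  have hne := qFac_ne_zero hq
  have hs : ∀ j, shiftExp (n₀ + 1) k (j + 1) = shiftExp n₀ k j + k := fun j => by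
    rw [shiftExp_eq, shiftExp_eq, mul_add_one]
    omega
  have h0 : shiftExp (n₀ + 1) k 0 = 0 := by simp [shiftExp]
  rw [constTerm_zero_succ, constTerm_eq_mul_prod hq hq₀ (Or.inl rfl), h, baseProd, baseProd,
    Nat.add_sub_add_right, mul_right_comm]
  congr 1
  rw [Finset.prod_range_succ', h0, zero_add, qFac_zero, one_mul, div_self (hne k), mul_one,
    ← Finset.prod_mul_distrib]
  refine Finset.prod_congr rfl fun j hj => ?_
  rw [Finset.mem_range] at hj
  rw [hs, if_neg (by omega), add_zero, add_zero, add_comm k (shiftExp n₀ k j), add_comm (k + k),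
    ← add_assoc]
  have h1 := hne k
  have h2 := hne (shiftExp n₀ k j)
  have h3 := hne (shiftExp n₀ k j + k)
  field_simp

/-- The `q`-Dyson case. -/
lemma constTerm_zero_self (hq : Function.Injective fun i : ℕ => q ^ i) (hq₀ : q ≠ 0) (n k : ℕ) :
    constTerm (qLaurent q (aomotoForresterMatrix n 0 n 0 0 k)) = baseProd q n n k := by
  induction n with
  | zero =>
    rw [constTerm_qLaurent_zero]
    simp [baseProd]
  | succ n ih => exact constTerm_zero_succ_eq hq hq₀ ih

lemma prod_Icc_one {M : Type*} [CommMonoid M] (f : ℕ → M) (d : ℕ) :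
    ∏ j ∈ Finset.Icc 1 d, f j = ∏ j ∈ Finset.range d, f (j + 1) := by
  induction d with
  | zero => simp
  | succ d ih => rw [Finset.prod_Icc_succ_top (by omega), ih, Finset.prod_range_succ]

/-- Here `shiftExp 0 k j = (k + 1) * j`, and the extra factors raise `qFac q ((k + 1) * j + k)` and
`qFac q k` by one step each. -/
lemma baseProd_zero (hq : Function.Injective fun i : ℕ => q ^ i) (n k : ℕ) :
    baseProd q n 0 k = baseProd q n n (k + 1) := by
  have hne := qFac_ne_zero hq
  rw [baseProd, baseProd, Nat.sub_zero, prod_Icc_one, prod_Icc_one, Nat.sub_self,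
    Finset.prod_range_zero, mul_one, ← Finset.prod_mul_distrib]
  refine Finset.prod_congr rfl fun j hj => ?_
  rw [Finset.mem_range] at hj
  rw [shiftExp_eq, shiftExp_eq, Nat.sub_zero, Nat.sub_eq_zero_of_le hj.le, add_zero,
    ← add_one_mul k j, ← add_assoc, qFac_succ q k, qFac_succ q ((k + 1) * j + k), add_assoc,
    ← mul_add_one]
  have h1 := hne (k + 1)
  rw [qFac_succ] at h1
  have h2 := left_ne_zero_of_mul h1
  have h3 := right_ne_zero_of_mul h1
  have h4 := hne ((k + 1) * j)
  field_simp

lemma constTerm_zero_eq_baseProd (hq : Function.Injective fun i : ℕ => q ^ i) (hq₀ : q ≠ 0)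
    {n n₀ : ℕ} (k : ℕ) (h : n₀ ≤ n) :
    constTerm (qLaurent q (aomotoForresterMatrix n 0 n₀ 0 0 k)) = baseProd q n n₀ k := by
  induction n₀ generalizing n with
  | zero => rw [aomotoForresterMatrix_zero_eq, constTerm_zero_self hq hq₀, baseProd_zero hq]
  | succ n₀ ih =>
    obtain ⟨n, rfl⟩ : ∃ n', n = n' + 1 := ⟨n - 1, by omega⟩
    exact constTerm_zero_succ_eq hq hq₀ (ih (by omega))

/-- The constant term identity of Aomoto–Forrester type. -/
theorem constTerm_aomotoForrester (hq : Function.Injective fun i : ℕ => q ^ i) (hq₀ : q ≠ 0)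
    (hm : m = 0 ∨ n ≤ m + n₀) (hn₀ : n₀ ≤ n) :
    constTerm (qLaurent q (aomotoForresterMatrix n m n₀ a b k)) =
      (∏ j ∈ Finset.range n,
        (qFac q (a + b + shiftExp n₀ k j + if n ≤ j + m then 1 else 0) *
            qFac q (shiftExp n₀ k j + k)) /
          (qFac q (a + shiftExp n₀ k j + if n ≤ j + m then 1 else 0) *
            qFac q (b + shiftExp n₀ k j) * qFac q k)) *
      ∏ j ∈ Finset.Icc 1 (n - n₀), (1 - q ^ ((k + 1) * j)) / (1 - q ^ (k + 1)) := by
  rw [constTerm_eq_mul_prod hq hq₀ hm, constTerm_zero_eq_baseProd hq hq₀ k hn₀, baseProd,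
    mul_right_comm]
  congr 1
  rw [← Finset.prod_mul_distrib]
  refine Finset.prod_congr rfl fun j _ => ?_
  have hne := qFac_ne_zero hq
  have h1 := hne k
  have h2 := hne (shiftExp n₀ k j)
  have h3 := hne (b + shiftExp n₀ k j)
  have h4 := hne (a + shiftExp n₀ k j + if n ≤ j + m then 1 else 0)
  field_simp

end Product

end

/-! ### Setting `x_0 = 1` and `q = 1`. -/

namespace LaurentPoly

variable {R : Type*} [CommRing R] {n : ℕ}

/-- The substitution of `1` for `x_0`. -/
noncomputable def tail : LaurentPoly R (Fin (n + 1)) →+* LaurentPoly R (Fin n) :=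
  AddMonoidAlgebra.mapDomainRingHom R
    (Finsupp.comapDomain.addMonoidHom (M := ℤ) (Fin.succ_injective n))

lemma tail_varPow_zero (e : ℤ) : tail (varPow R (0 : Fin (n + 1)) e) = 1 := by
  have : Finsupp.comapDomain.addMonoidHom (M := ℤ) (Fin.succ_injective n)
      (Finsupp.single 0 e) = 0 := by
    ext j
    simp
  rw [tail, varPow, AddMonoidAlgebra.mapDomainRingHom_apply, AddMonoidAlgebra.mapDomain_single,
    this, AddMonoidAlgebra.one_def]

lemma tail_varPow_succ (j : Fin n) (e : ℤ) : tail (varPow R j.succ e) = varPow R j e := by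
  have : Finsupp.comapDomain.addMonoidHom (M := ℤ) (Fin.succ_injective n)
      (Finsupp.single j.succ e) = Finsupp.single j e := by
    ext i
    simp [Finsupp.single_apply]
  rw [tail, varPow, AddMonoidAlgebra.mapDomainRingHom_apply, AddMonoidAlgebra.mapDomain_single,
    this, varPow]

lemma PolesLE.constTerm_tail {σ : Fin (n + 1) → ℕ} {f : LaurentPoly R (Fin (n + 1))}
    (hf : PolesLE σ f) : constTerm (tail f) = constTerm f := by
  -- Forgetting the exponent of `x_0` is injective on exponents of total degree zero, so no other
  -- monomial is mapped onto the constant one.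
  have h := Finsupp.mapDomain_apply' {e : Fin (n + 1) →₀ ℤ | ∑ i, e i = 0} f.coeff
    (f := Finsupp.comapDomain.addMonoidHom (M := ℤ) (Fin.succ_injective n))
    (fun e he => (hf e he).1) (fun e he e' he' h => ?_) (a := 0) (by simp)
  · rwa [map_zero] at h
  · rw [Set.mem_ofPred_eq, Fin.sum_univ_succ] at he he'
    have h1 : ∀ j : Fin n, e j.succ = e' j.succ := fun j => DFunLike.congr_fun h j
    simp only [h1] at he
    ext i
    induction i using Fin.cases with
    | zero => omega
    | succ i => exact h1 i

end LaurentPoly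

section

open LaurentPoly

section One

variable {R : Type*} [CommRing R] {n m n₀ a b k : ℕ}

lemma qPoch_one {A : Type*} [CommRing A] (t : A) (k : ℕ) : qPoch 1 t k = (1 - t) ^ k := by
  simp [qPoch]

lemma forresterPoly_eq : forresterPoly R n n₀ a b k =
    (∏ j : Fin n, (1 - varPow R j (-1)) ^ b * (1 - varPow R j 1) ^ a) *
      ∏ i : Fin n, ∏ j ∈ Finset.Ioi i,
        (1 - ratio R i j) ^ pairExp n₀ k i j * (1 - ratio R j i) ^ pairExp n₀ k j i := by
  rw [Finset.prod_prod_Ioi_mul_eq_prod_prod_off_diag (fun j i : Fin n =>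
    (1 - ratio R i j) ^ pairExp n₀ k i j)]
  simp_rw [forresterPoly, mul_assoc, mul_comm ((1 - varPow R _ (-1)) ^ b)]
  congr 1
  rw [← Finset.prod_mul_distrib]
  refine Finset.prod_congr rfl fun i _ => ?_
  rw [← Finset.prod_mul_distrib]
  symm
  refine (Finset.prod_congr rfl fun j hj => ?_).trans
    (Finset.prod_subset (Finset.subset_univ {i}ᶜ) fun j _ hj => ?_)
  · have hij : i ≠ j := by simpa [eq_comm] using hj
    rw [if_neg hij, pairExp]
    by_cases h : n₀ ≤ (i : ℕ) ∧ n₀ ≤ (j : ℕ)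
    · rw [if_pos h, if_pos ⟨hij, h⟩, pow_succ]
    · rw [if_neg h, if_neg fun h' => h h'.2, mul_one]
  · obtain rfl : j = i := by simpa using hj
    simp

lemma tail_qLaurent_one :
    tail (qLaurent (1 : R) (aomotoForresterMatrix n 0 n₀ a b k)) =
      forresterPoly R n n₀ a b k := by
  rw [forresterPoly_eq, qLaurent_eq_mul, map_mul, map_prod, map_prod]
  congr 1
  · refine Finset.prod_congr rfl fun j _ => ?_
    have := j.2
    rw [aomotoForresterMatrix_zero_succ, aomotoForresterMatrix_succ_zero, if_neg (by omega),
      map_one, one_mul, qPoch_one, qPoch_one, ratio, ratio]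
    simp [tail_varPow_zero, tail_varPow_succ]
  · refine Finset.prod_congr rfl fun i _ => ?_
    rw [map_prod]
    refine Finset.prod_congr rfl fun j hj => ?_
    have hij : i ≠ j := (Finset.mem_Ioi.1 hj).ne
    rw [aomotoForresterMatrix_succ_succ hij, aomotoForresterMatrix_succ_succ hij.symm,
      map_one, one_mul, qPoch_one, qPoch_one, ratio, ratio]
    simp [tail_varPow_succ, ratio]

lemma constTerm_forresterPoly : constTerm (forresterPoly R n n₀ a b k) =
    constTerm (qLaurent (1 : R) (aomotoForresterMatrix n 0 n₀ a b k)) := by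
  rw [← tail_qLaurent_one, (polesLE_qLaurent _).constTerm_tail]

lemma map_constTerm_qLaurent {S : Type*} [CommRing S] (φ : R →+* S) (q : R)
    (B : Matrix (Fin (n + 1)) (Fin (n + 1)) ℕ) :
    φ (constTerm (qLaurent q B)) = constTerm (qLaurent (φ q) B) := by
  have h1 : ∀ r : R, AddMonoidAlgebra.mapRingHom (Fin (n + 1) →₀ ℤ) φ
      (algebraMap R (LaurentPoly R (Fin (n + 1))) r) =
      algebraMap S (LaurentPoly S (Fin (n + 1))) (φ r) := fun r => by simp
  have h2 : ∀ i j : Fin (n + 1), AddMonoidAlgebra.mapRingHom (Fin (n + 1) →₀ ℤ) φ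
      (ratio R i j) = ratio S i j := fun i j => by
    rw [ratio, ratio, map_mul, varPow, varPow, AddMonoidAlgebra.mapRingHom_single,
      AddMonoidAlgebra.mapRingHom_single, map_one]
    rfl
  rw [constTerm, ← AddMonoidAlgebra.coeff_mapRingHom, constTerm, qLaurent, qLaurent, map_prod]
  simp_rw [map_prod, map_mul, map_qPoch, map_mul, h1, h2]

end One

/-! ### Specialization of the indeterminate `q` to `1`. -/

section Limit

open Polynomial

/-- The `q`-factorial, as a polynomial. -/
noncomputable def qFactorial (k : ℕ) : ℚ[X] :=
  ∏ s ∈ Finset.range k, ∑ i ∈ Finset.range (s + 1), X ^ i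

lemma qFac_X (k : ℕ) : qFac (X : ℚ[X]) k = (1 - X) ^ k * qFactorial k := by
  have h : (1 - X : ℚ[X]) ^ k = ∏ _s ∈ Finset.range k, (1 - X) := by
    rw [Finset.prod_const, Finset.card_range]
  rw [h, qFac, qPoch, qFactorial, ← Finset.prod_mul_distrib]
  refine Finset.prod_congr rfl fun s _ => ?_
  rw [mul_neg_geom_sum, pow_succ']

lemma eval_qFactorial (k : ℕ) : (qFactorial k).eval 1 = k.factorial := by
  simp [qFactorial, eval_prod, eval_finsetSum, ← Finset.prod_range_add_one_eq_factorial]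

lemma injective_ratFunc_X_pow : Function.Injective fun i : ℕ => (RatFunc.X : RatFunc ℚ) ^ i := by
  intro i j h
  have h1 : algebraMap ℚ[X] (RatFunc ℚ) (X ^ i) = algebraMap ℚ[X] (RatFunc ℚ) (X ^ j) := by
    simpa using h
  have h2 : (X : ℚ[X]) ^ i = X ^ j := IsFractionRing.injective ℚ[X] (RatFunc ℚ) h1
  simpa using congrArg natDegree h2

lemma constTerm_qLaurent_one {n n₀ a b k : ℕ} (hn₀ : n₀ ≤ n) :
    constTerm (qLaurent (1 : ℚ) (aomotoForresterMatrix n 0 n₀ a b k)) =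
      (∏ j ∈ Finset.range n,
        (((a + b + shiftExp n₀ k j).factorial : ℚ) * ((shiftExp n₀ k j + k).factorial : ℚ)) /
          (((a + shiftExp n₀ k j).factorial : ℚ) * ((b + shiftExp n₀ k j).factorial : ℚ) *
            (k.factorial : ℚ))) * ((n - n₀).factorial : ℚ) := by
  -- Over `ℚ[X]` the constant term can be evaluated at `1`; the product formula holds in `RatFunc
  -- ℚ`, so it is cleared of denominators and pulled back along `φ`.
  set c := constTerm (qLaurent (X : ℚ[X]) (aomotoForresterMatrix n 0 n₀ a b k)) with hc
  set φ := algebraMap ℚ[X] (RatFunc ℚ) with hφ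
  have hinj : Function.Injective φ := IsFractionRing.injective ℚ[X] (RatFunc ℚ)
  have hX : φ X = RatFunc.X := RatFunc.algebraMap_X
  have hne : ∀ e, φ (1 - X) ^ e * φ (qFactorial e) ≠ 0 := fun e => by
    rw [← map_pow, ← map_mul, ← qFac_X, qFac, map_qPoch, hX]
    exact qFac_ne_zero injective_ratFunc_X_pow e
  have hfac : ∀ e, qFac (RatFunc.X : RatFunc ℚ) e = φ (1 - X) ^ e * φ (qFactorial e) :=
    fun e => by rw [← map_pow, ← map_mul, ← qFac_X, qFac, qFac, map_qPoch, hX]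
  have hF : ∀ e, φ (qFactorial e) ≠ 0 := fun e => right_ne_zero_of_mul (hne e)
  have h1X : φ (1 - X) ≠ 0 := by simpa using left_ne_zero_of_mul (hne 1)
  have hgeom : ∀ d : ℕ, (1 - RatFunc.X ^ d : RatFunc ℚ) =
      φ (1 - X) * φ (∑ i ∈ Finset.range d, X ^ i) := fun d => by
    rw [← map_mul, mul_neg_geom_sum, map_sub, map_one, map_pow, hX]
  have hgne : φ (∑ i ∈ Finset.range (k + 1), X ^ i) ≠ 0 := by
    rw [Ne, map_eq_zero_iff φ hinj]
    intro h
    have := congrArg (eval 1) h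
    simp [eval_finsetSum] at this
    norm_cast at this
  have h1 := constTerm_aomotoForrester (m := 0) (a := a) (b := b) (k := k)
    injective_ratFunc_X_pow RatFunc.X_ne_zero (Or.inl rfl) hn₀
  rw [← hX, ← map_constTerm_qLaurent, ← hc, hX] at h1
  have h2 : φ c = (∏ j ∈ Finset.range n,
      φ (qFactorial (a + b + shiftExp n₀ k j) * qFactorial (shiftExp n₀ k j + k)) /
        φ (qFactorial (a + shiftExp n₀ k j) * qFactorial (b + shiftExp n₀ k j) *
          qFactorial k)) *
      ∏ j ∈ Finset.Icc 1 (n - n₀), φ (∑ i ∈ Finset.range ((k + 1) * j), X ^ i) /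
        φ (∑ i ∈ Finset.range (k + 1), X ^ i) := by
    rw [h1]
    congr 1
    · refine Finset.prod_congr rfl fun j hj => ?_
      rw [Finset.mem_range] at hj
      rw [if_neg (by omega), add_zero, add_zero]
      simp only [hfac, map_mul]
      have := hF k
      have := hF (a + shiftExp n₀ k j)
      have := hF (b + shiftExp n₀ k j)
      simp only [pow_add]
      field_simp
    · refine Finset.prod_congr rfl fun j _ => ?_
      rw [hgeom, hgeom, mul_div_mul_left _ _ h1X]
  rw [Finset.prod_div_distrib, Finset.prod_div_distrib, ← map_prod, ← map_prod, ← map_prod,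
    ← map_prod, div_mul_div_comm, ← map_mul, ← map_mul, eq_div_iff, ← map_mul] at h2
  swap
  · rw [map_mul, map_prod, map_prod]
    refine mul_ne_zero (Finset.prod_ne_zero_iff.2 fun j _ => ?_)
      (Finset.prod_ne_zero_iff.2 fun j _ => hgne)
    rw [map_mul, map_mul]
    exact mul_ne_zero (mul_ne_zero (hF _) (hF _)) (hF _)
  have h3 := congrArg (eval 1) (hinj h2)
  have h4 : eval 1 c = constTerm (qLaurent (1 : ℚ) (aomotoForresterMatrix n 0 n₀ a b k)) := by
    rw [hc, ← coe_evalRingHom, map_constTerm_qLaurent, coe_evalRingHom, eval_X]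
  simp only [eval_mul, eval_prod, eval_finsetSum, eval_pow, eval_X, one_pow, Finset.sum_const,
    Finset.card_range, nsmul_eq_mul, mul_one, eval_qFactorial, h4] at h3
  have h5 : ∏ x ∈ Finset.Icc 1 (n - n₀), (((k + 1) * x : ℕ) : ℚ) =
      (∏ _x ∈ Finset.Icc 1 (n - n₀), ((k + 1 : ℕ) : ℚ)) * ((n - n₀).factorial : ℚ) := by
    rw [← Finset.prod_range_add_one_eq_factorial, Nat.cast_prod, prod_Icc_one, prod_Icc_one, ← Finset.prod_mul_distrib]
    simp_rw [Nat.cast_mul]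
  rw [h5] at h3
  rw [Finset.prod_div_distrib, div_mul_eq_mul_div, eq_div_iff]
  -- At `q = 1` the last product is that of `(k + 1) * j / (k + 1)`; the powers of `k + 1` cancel
  -- and leave `(n - n₀)!`.
  · refine mul_right_cancel₀ (b := ∏ _x ∈ Finset.Icc 1 (n - n₀), ((k + 1 : ℕ) : ℚ)) ?_ ?_
    · exact Finset.prod_ne_zero_iff.2 fun _ _ => Nat.cast_ne_zero.2 k.succ_ne_zero
    · rw [mul_assoc, h3]
      ring
  · exact Finset.prod_ne_zero_iff.2 fun j _ => by positivity

lemma prod_shiftExp {n n₀ k : ℕ} (hn₀ : n₀ ≤ n) (f : ℕ → ℚ) :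
    ∏ j ∈ Finset.range n, f (shiftExp n₀ k j) =
      (∏ j ∈ Finset.range n₀, f (k * j)) *
        ∏ j ∈ Finset.range (n - n₀), f (k * n₀ + (k + 1) * j) := by
  obtain ⟨d, rfl⟩ := Nat.exists_eq_add_of_le hn₀
  rw [Finset.prod_range_add, Nat.add_sub_cancel_left]
  congr 1
  · refine Finset.prod_congr rfl fun j hj => ?_
    rw [Finset.mem_range] at hj
    rw [shiftExp_eq, Nat.sub_eq_zero_of_le hj.le, add_zero]
  · refine Finset.prod_congr rfl fun j _ => ?_
    rw [shiftExp_eq, Nat.add_sub_cancel_left]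
    congr 1
    ring

end Limit

end

theorem theorem6p2 (n : ℕ) (hn : 0 < n) (a b k n₀ : ℕ) (hn₀ : n₀ ≤ n)
    (q : RatFunc ℚ) (hq : q = RatFunc.X) :
    -- the Aomoto–Forrester constant term identity, with `q` an indeterminate
    (∀ m : ℕ, m ≤ n → n ≤ m + n₀ →
      LaurentPoly.constTerm (qLaurent q (aomotoForresterMatrix n m n₀ a b k)) =
        (∏ j ∈ Finset.range n,
          (qFac q (a + b + shiftExp n₀ k j + if n ≤ j + m then 1 else 0) *
              qFac q (shiftExp n₀ k j + k)) /
            (qFac q (a + shiftExp n₀ k j + if n ≤ j + m then 1 else 0) *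
              qFac q (b + shiftExp n₀ k j) * qFac q k)) *
        ∏ j ∈ Finset.Icc 1 (n - n₀), (1 - q ^ ((k + 1) * j)) / (1 - q ^ (k + 1))) ∧
    -- the Baker–Forrester identity, for all `n₀ ≤ n`
    (LaurentPoly.constTerm (qLaurent q (forresterMatrix n n₀ a b k)) =
        (∏ j ∈ Finset.range n,
          (qFac q (a + b + shiftExp n₀ k j) * qFac q (shiftExp n₀ k j + k)) /
            (qFac q (a + shiftExp n₀ k j) * qFac q (b + shiftExp n₀ k j) * qFac q k)) *
        ∏ j ∈ Finset.Icc 1 (n - n₀), (1 - q ^ ((k + 1) * j)) / (1 - q ^ (k + 1))) ∧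
    -- Forrester's identity
    LaurentPoly.constTerm (forresterPoly ℚ n n₀ a b k) =
      morrisProduct n₀ a b k *
        ∏ j ∈ Finset.range (n - n₀),
          (((j : ℚ) + 1) * ((a + b + k * n₀ + (k + 1) * j).factorial : ℚ) *
              ((k * n₀ + (k + 1) * j + k).factorial : ℚ)) /
            (((a + k * n₀ + (k + 1) * j).factorial : ℚ) *
              ((b + k * n₀ + (k + 1) * j).factorial : ℚ) * (k.factorial : ℚ)) := by
  subst hq
  refine ⟨fun m _ h => constTerm_aomotoForrester injective_ratFunc_X_pow RatFunc.X_ne_zero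
    (Or.inr h) hn₀, ?_, ?_⟩
  · rw [forresterMatrix_eq, constTerm_aomotoForrester injective_ratFunc_X_pow RatFunc.X_ne_zero
      (Or.inl rfl) hn₀]
    congr 1
    refine Finset.prod_congr rfl fun j hj => ?_
    rw [Finset.mem_range] at hj
    rw [if_neg (by omega), add_zero, add_zero]
  · rw [constTerm_forresterPoly, constTerm_qLaurent_one hn₀, prod_shiftExp hn₀ fun e =>
      (((a + b + e).factorial : ℚ) * ((e + k).factorial : ℚ)) /
        (((a + e).factorial : ℚ) * ((b + e).factorial : ℚ) * (k.factorial : ℚ)),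
      morrisProduct, mul_assoc, ← Finset.prod_range_add_one_eq_factorial (n - n₀), Nat.cast_prod,
      ← Finset.prod_mul_distrib]
    congr 1
    refine Finset.prod_congr rfl fun j _ => ?_
    simp only [← add_assoc]
    push_cast
    ring
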